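/- Let $m,n,d$ be natural numbers with $m>d+1$, let $A\in\mathbb{R}^{n\times d}$ have full column rank $d$, let $y\in\mathbb{R}^n$, and let $S\in\mathbb{R}^{m\times n}$ be a random matrix with i.i.d. entries $S_{ij}\sim\mathcal N(0,1/m)$. For a data pair $(A,y)$ with $A$ of full column rank write $x_{LS}=x_{LS}(A,y)=\arg\min_{x\in\mathbb{R}^d}\|Ax-y\|_2^2$ and $y^\perp=y-Ax_{LS}$. An estimator is a Borel function $f:\mathbb{R}^{m\times d}\times\mathbb{R}^m\to\mathbb{R}^d$, giving $\widetilde x=f(SA,Sy)$. We consider two notions of unbiasedness. (U) $f$ is unbiased if, for every $A'\in\mathbb{R}^{n\times d}$ of full column rank and every $y'\in\mathbb{R}^n$, $f(SA',Sy')$ is integrable and $\mathbb{E}[f(SA',Sy')]=x_{LS}(A',y')$. (C) $f$, which may be chosen depending on $A$ and $y^\perp$, is conditionally unbiased at $A$ and $y^\perp$ if, for every $x\in\mathbb{R}^d$ and $y'=Ax+y^\perp$ (so that $x_{LS}(A,y')=x$), $f(SA,Sy')$ is integrable and $\mathbb{E}[f(SA,Sy')\mid SA]=x$ almost surely. If $f$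 satisfies (U) or $f$ satisfies (C), then $$\mathbb{E}\left[\|A(\widetilde x-x_{LS})\|_2^2\right]\;\ge\;\frac{d}{m-d-1}\,\|y^\perp\|_2^2 ,$$ where the left side may be $+\infty$. Moreover, the sketched problem $\min_{x}\|SAx-Sy\|_2^2$ almost surely has a unique solution $\widehat x$ (set $\widehat x=0$ when the solution is not unique); $\widehat x$ is an estimator that satisfies both (U) and (C), and it attains the bound: $$\mathbb{E}\left[\|A(\widehat x-x_{LS})\|_2^2\right]=\frac{d}{m-d-1}\,\|y^\perp\|_2^2 .$$ Hence $\widehat x$ is a minimum variance unbiased estimator of $x_{LS}$ among functions of $(SA,Sy)$, and the bound is tight: the infimum of $\mathbb{E}[\|A(\widetilde x-x_{LS})\|_2^2]$ over all estimators satisfying (U), and likewise the infimum over all estimators satisfying (C), equals $\frac{d}{m-d-1}\|y^\perp\|_2^2$. -/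

import Mathlib

open MeasureTheory ProbabilityTheory Matrix
open scoped NNReal ENNReal

namespace GaussianSketch

/-- The Borel (product) σ-algebra on real matrices. -/
instance instMeasurableSpaceMatrix {k l : ℕ} : MeasurableSpace (Matrix (Fin k) (Fin l) ℝ) :=
  inferInstanceAs (MeasurableSpace (Fin k → Fin l → ℝ))

/-- The squared Euclidean norm of a real vector. -/
def sqNorm {k : ℕ} (v : Fin k → ℝ) : ℝ := ∑ i, v i ^ 2

/-- `x` minimizes `z ↦ ‖A z - y‖₂²` over all of `ℝ^d`. -/
def IsLeastSquares {n d : ℕ} (A : Matrix (Fin n) (Fin d) ℝ) (y : Fin n → ℝ) (x : Fin d → ℝ) :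
    Prop :=
  ∀ z : Fin d → ℝ, sqNorm (A *ᵥ x - y) ≤ sqNorm (A *ᵥ z - y)

open Classical in
/-- The unique minimizer of `x ↦ ‖A x - y‖₂²`. It exists exactly when `A` has full column rank;
otherwise the value is `0` by convention. -/
noncomputable def lsSol {n d : ℕ} (A : Matrix (Fin n) (Fin d) ℝ) (y : Fin n → ℝ) : Fin d → ℝ :=
  if h : ∃! x, IsLeastSquares A y x then h.choose else 0

/-- The residual `y⊥ = y - A x_LS`. -/
noncomputable def residual {n d : ℕ} (A : Matrix (Fin n) (Fin d) ℝ) (y : Fin n → ℝ) :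
    Fin n → ℝ :=
  y - A *ᵥ lsSol A y

/-- `S` is a random `m × n` matrix with i.i.d. entries of law `N(0, 1/m)`. -/
structure IsGaussianSketch {Ω : Type*} [MeasurableSpace Ω] (μ : Measure Ω) {m n : ℕ}
    (S : Ω → Matrix (Fin m) (Fin n) ℝ) : Prop where
  measurable : ∀ i j, Measurable (fun ω => S ω i j)
  law : ∀ i j, μ.map (fun ω => S ω i j) = gaussianReal 0 ((m : ℝ≥0)⁻¹)
  indep : iIndepFun (fun (p : Fin m × Fin n) ω => S ω p.1 p.2) μ

/-- An estimator is a function of the sketched data `(SA, Sy)`. -/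
abbrev Estimator (m d : ℕ) : Type :=
  Matrix (Fin m) (Fin d) ℝ × (Fin m → ℝ) → (Fin d → ℝ)

/-- The value of the estimator `f` on the sketched data, as a random vector. -/
def estimate {Ω : Type*} {m n d : ℕ} (S : Ω → Matrix (Fin m) (Fin n) ℝ) (f : Estimator m d)
    (A : Matrix (Fin n) (Fin d) ℝ) (y : Fin n → ℝ) : Ω → (Fin d → ℝ) :=
  fun ω => f (S ω * A, S ω *ᵥ y)

/-- Sketch-and-solve: the least squares solution of the sketched problem,
`x̂ = argmin ‖SA x - Sy‖₂²`. -/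
noncomputable def classicalSketch (m d : ℕ) : Estimator m d := fun p => lsSol p.1 p.2

/-- The prediction error `E ‖A (x̃ - x_LS)‖₂²`, possibly infinite. -/
noncomputable def predError {Ω : Type*} [MeasurableSpace Ω] (μ : Measure Ω) {m n d : ℕ}
    (S : Ω → Matrix (Fin m) (Fin n) ℝ) (f : Estimator m d)
    (A : Matrix (Fin n) (Fin d) ℝ) (y : Fin n → ℝ) : ℝ≥0∞ :=
  ∫⁻ ω, ENNReal.ofReal (sqNorm (A *ᵥ (estimate S f A y ω - lsSol A y))) ∂μ

/-- `f` is an unbiased estimator of the least squares solution: `E x̃ = x_LS`, whatever the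
data `(A, y)` with `A` of full column rank. -/
def IsUnbiased {Ω : Type*} [MeasurableSpace Ω] (μ : Measure Ω) {m n d : ℕ}
    (S : Ω → Matrix (Fin m) (Fin n) ℝ) (f : Estimator m d) : Prop :=
  Measurable f ∧
    ∀ A : Matrix (Fin n) (Fin d) ℝ, A.rank = d → ∀ y : Fin n → ℝ,
      Integrable (estimate S f A y) μ ∧ ∫ ω, estimate S f A y ω ∂μ = lsSol A y

/-- `f` is unbiased conditionally on `SA`: `E[x̃ | SA] = x_LS` almost surely, where `A` and the
residual of `y` are fixed and only the least squares solution varies. The estimator `f` may be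
tuned to `A` and to this residual. -/
def IsCondUnbiased {Ω : Type*} [MeasurableSpace Ω] (μ : Measure Ω) {m n d : ℕ}
    (S : Ω → Matrix (Fin m) (Fin n) ℝ) (A : Matrix (Fin n) (Fin d) ℝ) (y : Fin n → ℝ)
    (f : Estimator m d) : Prop :=
  Measurable f ∧
    ∀ x : Fin d → ℝ,
      Integrable (estimate S f A (A *ᵥ x + residual A y)) μ ∧
      μ[estimate S f A (A *ᵥ x + residual A y) |
          MeasurableSpace.comap (fun ω => S ω * A) inferInstance] =ᵐ[μ] fun _ => x

/-- The value `d ‖y⊥‖₂² / (m - d - 1)`. -/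
noncomputable def errorBound (m : ℕ) {n d : ℕ} (A : Matrix (Fin n) (Fin d) ℝ) (y : Fin n → ℝ) :
    ℝ :=
  (d : ℝ) / ((m : ℝ) - (d : ℝ) - 1) * sqNorm (residual A y)

end GaussianSketch

namespace GaussianSketch

set_option linter.unusedSectionVars false

/-! The argument is the covariance form of the Lehmann–Scheffé theorem. Let `D` be the difference
between an unbiased estimator and the sketched least squares solution `x̂`. It is an unbiased
estimator of zero. If every coordinate of `D` is uncorrelated with every coordinate of `x̂ - x_LS`,
then expanding `‖A(D + x̂ - x_LS)‖²` shows that `x̂` has the smaller error.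
`errorBound_le_predError` is this reduction, and each notion of unbiasedness has its own reason for
the correlation to vanish.

Under (U), the augmented matrix `(SA | Sy)` has i.i.d. centered Gaussian rows, and its covariance
can be varied freely by changing the data. Changing the covariance multiplies the density, up to a
constant, by the exponential of a linear form in the Gram matrix. Hence the Laplace transform of the
Gram matrix under the signed density `D` vanishes near the origin, and so does the signed law itself
(`sameSignedLaw_gramEntries`). By the normal equations `x̂` is a function of the Gram matrix, so `D`
is uncorrelated with it.

Under (C), `SA` and `Sy⊥` are independent: they have the joint law of `GR` and `cg`, with `G` and
`g` standard Gaussian. Moving `x` shifts `g` along the columns of `X = GR`. By Cameron–Martin a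
shift along a column `u` is an exponential tilt in `⟨g, u⟩`. Unbiasedness for all `x` then kills the
Laplace transform of this score, and `D` is uncorrelated with `h(G)⟨g, u⟩`
(`integral_mul_score_eq_zero`). Now `x̂ - x = c (XᵀX)⁻¹Xᵀg` is a combination of scores with
coefficients depending on `G`; these are truncated, and the truncation is removed by a limit.

In both cases the analytic input is `sameSignedLaw_of_exp`: a signed density with vanishing Laplace
transform near zero has zero image law.

For the exact error of `x̂`, the factor `R` cancels and `‖y⊥‖² E tr (GᵀG)⁻¹` remains. A diagonal
entry of `(GᵀG)⁻¹` is the inverse squared distance from one column to the span of the `d - 1`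
others, that is, an inverse chi-square variable with `m - d + 1` degrees of freedom. Its mean is
`1/(m - d - 1)` (`lintegral_inv_gram`). -/

/-- The law of a vector of i.i.d. standard normal variables. -/
noncomputable def stdNormal (ι : Type*) [Fintype ι] : Measure (ι → ℝ) :=
  Measure.pi fun _ => gaussianReal 0 1

/-! ### Standard Gaussian vectors: density, changes of variables, linear images. -/

section StdNormal

variable {ι : Type*} [Fintype ι]

instance : IsProbabilityMeasure (stdNormal ι) := by
  unfold stdNormal; infer_instance

lemma stdNormal_eq_withDensity :
    stdNormal ι = volume.withDensity (fun x => ENNReal.ofReal (∏ i, gaussianPDFReal 0 1 (x i))) := by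
  refine Measure.pi_eq fun s hs => ?_
  rw [withDensity_apply _ (MeasurableSet.univ_pi hs), volume_pi, Measure.restrict_pi_pi,
    ← ofReal_integral_eq_lintegral_ofReal,
    integral_fintype_prod_eq_prod (f := fun _ x => gaussianPDFReal 0 1 x),
    ENNReal.ofReal_prod_of_nonneg]
  · refine Finset.prod_congr rfl fun i _ => ?_
    rw [gaussianReal_apply_eq_integral _ one_ne_zero]
  · exact fun i _ => integral_nonneg fun x => gaussianPDFReal_nonneg _ _ _
  · exact Integrable.fintype_prod (f := fun _ x => gaussianPDFReal 0 1 x)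
      fun i => (integrable_gaussianPDFReal 0 1).restrict
  · exact ae_of_all _ fun x => Finset.prod_nonneg fun i _ => gaussianPDFReal_nonneg _ _ _

lemma stdNormal_absolutelyContinuous : stdNormal ι ≪ volume := by
  rw [stdNormal_eq_withDensity]; exact withDensity_absolutelyContinuous _ _

lemma prod_gaussianPDFReal (x : ι → ℝ) :
    ∏ i, gaussianPDFReal 0 1 (x i) =
      (√(2 * Real.pi))⁻¹ ^ Fintype.card ι * Real.exp (-(∑ i, x i ^ 2) / 2) := by
  simp only [gaussianPDFReal, sub_zero, NNReal.coe_one, mul_one, Finset.prod_mul_distrib,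
    Finset.prod_const, Finset.card_univ, ← Real.exp_sum, ← Finset.sum_neg_distrib, Finset.sum_div]

/-- Change of variables for the standard normal law. -/
lemma stdNormal_map_equiv (φ : (ι → ℝ) ≃ᵐ (ι → ℝ)) (a : ℝ≥0∞)
    (hφ : (volume : Measure (ι → ℝ)).map φ = a • volume) :
    (stdNormal ι).map φ = a • (stdNormal ι).withDensity (fun x =>
      ENNReal.ofReal (Real.exp ((∑ i, x i ^ 2) / 2 - (∑ i, φ.symm x i ^ 2) / 2))) := by
  have hm : Measurable fun x : ι → ℝ => ENNReal.ofReal (∏ i, gaussianPDFReal 0 1 (x i)) := by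
    refine ENNReal.measurable_ofReal.comp (Finset.measurable_prod _ fun i _ => ?_)
    exact (measurable_gaussianPDFReal 0 1).comp (measurable_pi_apply i)
  have hs : Measurable φ.symm := φ.symm.measurable
  have hm2 : Measurable fun x : ι → ℝ => ENNReal.ofReal
      (Real.exp ((∑ i, x i ^ 2) / 2 - (∑ i, φ.symm x i ^ 2) / 2)) := by
    have : ∀ i, Measurable fun x => φ.symm x i := fun i => (measurable_pi_apply i).comp hs
    fun_prop
  have h1 : (stdNormal ι).map φ =
      (a • (volume : Measure (ι → ℝ))).withDensity
        (fun x => ENNReal.ofReal (∏ i, gaussianPDFReal 0 1 (φ.symm x i))) := by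
    ext s hs
    rw [φ.map_apply, stdNormal_eq_withDensity, withDensity_apply _ (φ.measurable hs),
      withDensity_apply _ hs, ← hφ, φ.restrict_map, lintegral_map_equiv]
    simp
  rw [h1, withDensity_smul_measure]
  congr 1
  rw [stdNormal_eq_withDensity, ← withDensity_mul _ hm hm2]
  congr 1
  ext x
  rw [Pi.mul_apply, ← ENNReal.ofReal_mul
    (Finset.prod_nonneg fun i _ => gaussianPDFReal_nonneg _ _ _), prod_gaussianPDFReal,
    prod_gaussianPDFReal, mul_assoc, ← Real.exp_add]
  congr 3
  ring

/-- Translation preserves volume, and `|x|²/2 - |x - u|²/2 = ⟨x, u⟩ - |u|²/2`. -/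
lemma stdNormal_map_add (u : ι → ℝ) :
    (stdNormal ι).map (fun x => x + u) = (stdNormal ι).withDensity (fun x =>
      ENNReal.ofReal (Real.exp (∑ i, x i * u i - (∑ i, u i ^ 2) / 2))) := by
  have := stdNormal_map_equiv (MeasurableEquiv.addRight u) 1
    (by rw [one_smul]; exact map_add_right_eq_self _ u)
  rw [one_smul] at this
  refine this.trans ?_
  congr 1
  ext x
  congr 2
  simp only [MeasurableEquiv.symm_addRight, MeasurableEquiv.coe_addRight, Pi.add_apply,
    Pi.neg_apply, Finset.sum_div, ← Finset.sum_sub_distrib]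
  exact Finset.sum_congr rfl fun i _ => by ring

/-- The exponent is the covariance form of `L`, so identifying laws of Gaussian images reduces to
comparing covariances. -/
lemma charFunDual_stdNormal [DecidableEq ι] (L : StrongDual ℝ (ι → ℝ)) :
    charFunDual (stdNormal ι) L =
      Complex.exp (-((∑ i, L (Pi.single i 1) ^ 2 : ℝ) : ℂ) / 2) := by
  rw [stdNormal, charFunDual_pi]
  have : ∀ i, charFunDual (gaussianReal 0 1) (L.comp (.single ℝ (fun _ => ℝ) i)) =
      Complex.exp (-((L (Pi.single i 1) ^ 2 : ℝ) : ℂ) / 2) := by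
    intro i
    have h : ∀ v : ℝ, L (Pi.single i v) = L (Pi.single i 1) * v := by
      intro v
      have : (Pi.single i v : ι → ℝ) = v • Pi.single i 1 := by simp [← Pi.single_smul]
      rw [this, map_smul, smul_eq_mul, mul_comm]
    rw [charFunDual_apply]
    have h2 := charFun_gaussianReal (μ := 0) (v := 1) (L (Pi.single i 1))
    rw [charFun_apply_real] at h2
    have h3 : ∀ v : ℝ, (L.comp (.single ℝ (fun _ => ℝ) i)) v = L (Pi.single i 1) * v :=
      fun v => h v
    simp_rw [h3, Complex.ofReal_mul]
    rw [h2]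
    rw [Complex.ofReal_zero, NNReal.coe_one, Complex.ofReal_one, Complex.ofReal_pow]
    congr 1
    ring
  simp_rw [this, ← Complex.exp_sum]
  push_cast
  rw [← Finset.sum_div, Finset.sum_neg_distrib]

/-- Images of standard normal laws under linear maps agree as soon as the covariances do. -/
lemma stdNormal_map_eq_map [DecidableEq ι] {κ E : Type*} [Fintype κ] [DecidableEq κ]
    [NormedAddCommGroup E] [NormedSpace ℝ E] [MeasurableSpace E] [BorelSpace E]
    [SecondCountableTopology E] [CompleteSpace E]
    (L : (ι → ℝ) →ₗ[ℝ] E) (L' : (κ → ℝ) →ₗ[ℝ] E)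
    (h : ∀ l : StrongDual ℝ E,
      ∑ i, l (L (Pi.single i 1)) ^ 2 = ∑ k, l (L' (Pi.single k 1)) ^ 2) :
    (stdNormal ι).map L = (stdNormal κ).map L' := by
  have hL : Continuous L := L.continuous_of_finiteDimensional
  have hL' : Continuous L' := L'.continuous_of_finiteDimensional
  have : IsProbabilityMeasure ((stdNormal ι).map L) :=
    Measure.isProbabilityMeasure_map hL.measurable.aemeasurable
  have : IsProbabilityMeasure ((stdNormal κ).map L') :=
    Measure.isProbabilityMeasure_map hL'.measurable.aemeasurable
  refine Measure.ext_of_charFunDual (funext fun l => ?_)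
  have e1 := charFunDual_map (μ := stdNormal ι) (⟨L, hL⟩ : (ι → ℝ) →L[ℝ] E) l
  have e2 := charFunDual_map (μ := stdNormal κ) (⟨L', hL'⟩ : (κ → ℝ) →L[ℝ] E) l
  rw [charFunDual_stdNormal] at e1 e2
  refine e1.trans (Eq.trans ?_ e2.symm)
  simp only [ContinuousLinearMap.comp_apply]
  exact congrArg (fun r : ℝ => Complex.exp (-(r : ℂ) / 2)) (h l)

lemma stdNormal_sum {κ : Type*} [Fintype κ] :
    (stdNormal (ι ⊕ κ)).map (fun x => (fun i => x (.inl i), fun k => x (.inr k))) =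
      (stdNormal ι).prod (stdNormal κ) :=
  (measurePreserving_sumPiEquivProdPi (ι := ι) (ι' := κ) (fun _ => gaussianReal 0 1)).map_eq

lemma stdNormal_map_neg : (stdNormal ι).map (fun x => -x) = stdNormal ι := by
  classical
  have := stdNormal_map_eq_map (-LinearMap.id : (ι → ℝ) →ₗ[ℝ] (ι → ℝ)) LinearMap.id
    (fun l => by simp)
  rwa [LinearMap.id_coe, Measure.map_id] at this

lemma integrable_sq_dotProduct_stdNormal (p : ι → ℝ) :
    Integrable (fun x => (p ⬝ᵥ x) ^ 2) (stdNormal ι) ∧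
      ∫ x, (p ⬝ᵥ x) ^ 2 ∂stdNormal ι = ∑ i, p i ^ 2 := by
  have hL : ∀ i, MemLp (fun x : ℝ => p i * x) 2 (gaussianReal 0 1) := fun i =>
    (memLp_id_gaussianReal 2).const_mul _
  have hmem : ∀ i, MemLp (fun x : ι → ℝ => p i * x i) 2 (stdNormal ι) := fun i =>
    (hL i).comp_measurePreserving (measurePreserving_eval (fun _ : ι => gaussianReal 0 1) i)
  have hsum : MemLp (fun x : ι → ℝ => p ⬝ᵥ x) 2 (stdNormal ι) := by
    simpa [dotProduct] using memLp_finsetSum Finset.univ fun i _ => hmem i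
  refine ⟨hsum.integrable_sq, ?_⟩
  have hmean : ∫ x, p ⬝ᵥ x ∂stdNormal ι = 0 := by
    simp only [dotProduct]
    rw [integral_finsetSum _ fun i _ => (hmem i).integrable (by norm_num)]
    refine Finset.sum_eq_zero fun i _ => ?_
    rw [integral_const_mul, stdNormal, integral_eval]
    simp
  have hv := variance_of_integral_eq_zero hsum.aestronglyMeasurable.aemeasurable hmean
  rw [← hv]
  have := variance_sum_pi (μ := fun _ : ι => gaussianReal 0 1) (X := fun i x => p i * x) hL
  have e : (fun x : ι → ℝ => p ⬝ᵥ x) = ∑ i, fun x : ι → ℝ => p i * x i := by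
    ext x; simp [dotProduct]
  rw [e]
  refine this.trans (Finset.sum_congr rfl fun i _ => ?_)
  rw [variance_const_mul, variance_fun_id_gaussianReal, NNReal.coe_one, mul_one]

end StdNormal

/-! ### The mean of an inverse chi-square variable. -/

section InverseChiSquare

lemma integral_exp_neg_mul_sq_gaussianReal {s : ℝ} (hs : 0 < s) :
    ∫ x, Real.exp (-s * x ^ 2) ∂gaussianReal 0 1 = (√(1 + 2 * s))⁻¹ := by
  rw [integral_gaussianReal_eq_integral_smul one_ne_zero]
  have : ∀ x : ℝ, gaussianPDFReal 0 1 x • Real.exp (-s * x ^ 2) =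
      (√(2 * Real.pi))⁻¹ * Real.exp (-(1 / 2 + s) * x ^ 2) := by
    intro x
    simp only [gaussianPDFReal, sub_zero, NNReal.coe_one, mul_one, smul_eq_mul, mul_assoc,
      ← Real.exp_add]
    congr 2; ring
  simp_rw [this]
  rw [integral_const_mul, integral_gaussian, ← Real.sqrt_inv, ← Real.sqrt_inv,
    ← Real.sqrt_mul (by positivity)]
  congr 1
  have := Real.pi_pos
  field_simp

lemma lintegral_exp_neg_mul_stdNormal {ι : Type*} [Fintype ι] {s : ℝ} (hs : 0 < s) :
    ∫⁻ x, ENNReal.ofReal (Real.exp (-s * ∑ i, x i ^ 2)) ∂stdNormal ι =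
      ENNReal.ofReal ((1 + 2 * s) ^ (-(Fintype.card ι : ℝ) / 2)) := by
  have e : ∀ x : ι → ℝ, Real.exp (-s * ∑ i, x i ^ 2) = ∏ i, Real.exp (-s * x i ^ 2) := fun x => by
    rw [← Real.exp_sum, Finset.mul_sum]
  have hint : Integrable (fun x : ℝ => Real.exp (-s * x ^ 2)) (gaussianReal 0 1) := by
    refine (integrable_const (1 : ℝ)).mono' (by fun_prop) (ae_of_all _ fun x => ?_)
    rw [Real.norm_eq_abs, Real.abs_exp]
    exact Real.exp_le_one_iff.2 (by nlinarith [sq_nonneg x])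
  simp_rw [e]
  rw [stdNormal, ← ofReal_integral_eq_lintegral_ofReal]
  · rw [integral_fintype_prod_eq_prod (f := fun _ x => Real.exp (-s * x ^ 2))]
    rw [Finset.prod_const, Finset.card_univ, integral_exp_neg_mul_sq_gaussianReal hs,
      Real.sqrt_eq_rpow, ← Real.rpow_neg (by positivity), ← Real.rpow_natCast,
      ← Real.rpow_mul (by positivity)]
    congr 2; ring
  · exact Integrable.fintype_prod (f := fun _ x => Real.exp (-s * x ^ 2)) fun i => hint
  · exact ae_of_all _ fun x => Finset.prod_nonneg fun i _ => (Real.exp_pos _).le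

lemma lintegral_rpow_Ioi {k : ℝ} (hk : 2 < k) :
    ∫⁻ s in Set.Ioi (0 : ℝ), ENNReal.ofReal ((1 + 2 * s) ^ (-k / 2)) =
      ENNReal.ofReal (1 / (k - 2)) := by
  have hk' : k - 2 ≠ 0 := by linarith
  have hd : ∀ s ∈ Set.Ici (0 : ℝ), HasDerivAt
      (fun s : ℝ => -((1 + 2 * s) ^ (1 - k / 2) / (k - 2))) ((1 + 2 * s) ^ (-k / 2)) s := by
    intro s hs
    have hs' : (0 : ℝ) ≤ s := hs
    have h1 : HasDerivAt (fun s : ℝ => 1 + 2 * s) 2 s := by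
      simpa using ((hasDerivAt_id s).const_mul 2).const_add 1
    have h2 := ((h1.rpow_const (p := 1 - k / 2) (Or.inl (by positivity))).div_const (k - 2)).neg
    refine h2.congr_deriv ?_
    rw [show 1 - k / 2 - 1 = -k / 2 by ring]
    field_simp
    ring
  have ht : Filter.Tendsto (fun s : ℝ => -((1 + 2 * s) ^ (1 - k / 2) / (k - 2))) Filter.atTop
      (nhds 0) := by
    have h1 : Filter.Tendsto (fun s : ℝ => 1 + 2 * s) Filter.atTop Filter.atTop :=
      Filter.tendsto_atTop_add_const_left _ _ (Filter.tendsto_id.const_mul_atTop (by norm_num))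
    have h2 := (tendsto_rpow_neg_atTop (y := k / 2 - 1) (by linarith)).comp h1
    have h3 := (h2.div_const (k - 2)).neg
    simp only [zero_div, neg_zero, neg_sub] at h3
    exact h3
  have hpos : ∀ s ∈ Set.Ioi (0 : ℝ), 0 ≤ (1 + 2 * s) ^ (-k / 2) := fun s hs => by
    have : (0 : ℝ) < s := hs
    positivity
  rw [← ofReal_integral_eq_lintegral_ofReal
    (integrableOn_Ioi_deriv_of_nonneg' hd hpos ht)
    ((ae_restrict_iff' measurableSet_Ioi).2 (ae_of_all _ hpos)),
    integral_Ioi_of_hasDerivAt_of_nonneg' hd hpos ht]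
  simp

lemma ae_sum_sq_pos_stdNormal {ι : Type*} [Fintype ι] [Nonempty ι] :
    ∀ᵐ x ∂stdNormal ι, 0 < ∑ i, x i ^ 2 := by
  have h : ∀ᵐ x : ι → ℝ, x ≠ 0 := by
    simp [ae_iff]
  filter_upwards [stdNormal_absolutelyContinuous.ae_le h] with x hx
  obtain ⟨i, hi⟩ := Function.ne_iff.1 hx
  exact Finset.sum_pos' (fun i _ => sq_nonneg _) ⟨i, Finset.mem_univ _, by
    have : x i ≠ 0 := hi
    positivity⟩

/-- The mean of the inverse of a chi-square variable. -/
lemma lintegral_inv_sum_sq_stdNormal {ι : Type*} [Fintype ι] (h : 2 < Fintype.card ι) :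
    ∫⁻ x, ENNReal.ofReal (∑ i, x i ^ 2)⁻¹ ∂stdNormal ι =
      ENNReal.ofReal (1 / ((Fintype.card ι : ℝ) - 2)) := by
  have : Nonempty ι := Fintype.card_pos_iff.1 (by omega)
  -- The identity `1/q = ∫ exp(-s q) ds` over `s > 0` turns the inverse moment into an integral of
  -- Laplace transforms, by Tonelli.
  have h1 : ∀ᵐ x ∂stdNormal ι, ENNReal.ofReal (∑ i, x i ^ 2)⁻¹ =
      ∫⁻ s in Set.Ioi (0 : ℝ), ENNReal.ofReal (Real.exp (-s * ∑ i, x i ^ 2)) := by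
    filter_upwards [ae_sum_sq_pos_stdNormal (ι := ι)] with x hx
    have hneg : -∑ i, x i ^ 2 < 0 := by linarith
    have e : ∀ s : ℝ, -s * ∑ i, x i ^ 2 = (-∑ i, x i ^ 2) * s := fun s => by ring
    simp_rw [e]
    rw [← ofReal_integral_eq_lintegral_ofReal (integrableOn_exp_mul_Ioi hneg 0)
      (ae_of_all _ fun s => (Real.exp_pos _).le), integral_exp_mul_Ioi hneg]
    simp [neg_div, div_neg]
  rw [lintegral_congr_ae h1, lintegral_lintegral_swap (by fun_prop),
    setLIntegral_congr_fun measurableSet_Ioi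
      (fun s hs => lintegral_exp_neg_mul_stdNormal (ι := ι) hs)]
  exact lintegral_rpow_Ioi (by exact_mod_cast h)

end InverseChiSquare

/-! ### Resampling a column, and almost sure independence of columns. -/

section ColumnIndependence

variable {m : ℕ} {κ : Type*} [Fintype κ] [DecidableEq κ]

/-- Replace the column `j` of a matrix, given by its entries, by `g`. -/
def replaceCol (j : κ) (x : Fin m × κ → ℝ) (g : Fin m → ℝ) : Fin m × κ → ℝ :=
  fun p => if p.2 = j then g p.1 else x p

lemma measurable_replaceCol (j : κ) :
    Measurable fun p : (Fin m × κ → ℝ) × (Fin m → ℝ) => replaceCol j p.1 p.2 := by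
  refine measurable_pi_iff.2 fun q => ?_
  unfold replaceCol
  split_ifs <;> fun_prop

/-- Resampling a column does not change the law of a Gaussian matrix. -/
lemma map_replaceCol_stdNormal (j : κ) :
    ((stdNormal (Fin m × κ)).prod (stdNormal (Fin m))).map
      (fun p => replaceCol j p.1 p.2) = stdNormal (Fin m × κ) := by
  rw [← stdNormal_sum, Measure.map_map (measurable_replaceCol j) (by fun_prop)]
  let L : (((Fin m × κ) ⊕ Fin m) → ℝ) →ₗ[ℝ] (Fin m × κ → ℝ) :=
    { toFun := fun w => replaceCol j (fun p => w (.inl p)) (fun i => w (.inr i))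
      map_add' := fun a b => by
        ext p; simp only [replaceCol, Pi.add_apply]; split_ifs <;> rfl
      map_smul' := fun c a => by
        ext p; simp only [replaceCol, Pi.smul_apply, RingHom.id_apply]; split_ifs <;> rfl }
  have h := stdNormal_map_eq_map L LinearMap.id (fun l => by
    -- `L` kills the basis vectors of the old column `j` and sends those of the fresh vector to
    -- column `j`, so the image covariance is again the identity.
    have h1 : ∀ i : Fin m, L (Pi.single (.inr i) 1) = Pi.single (i, j) 1 := fun i => by
      ext ⟨i', k⟩
      simp only [L, LinearMap.coe_mk, AddHom.coe_mk, replaceCol, Pi.single_apply, Prod.mk.injEq,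
        Sum.inr.injEq, reduceCtorEq, if_false]
      split_ifs <;> simp_all
    have h2 : ∀ p : Fin m × κ, L (Pi.single (.inl p) 1) =
        if p.2 = j then 0 else Pi.single p 1 := fun p => by
      ext ⟨i', k⟩
      obtain ⟨i, k'⟩ := p
      simp only [L, LinearMap.coe_mk, AddHom.coe_mk, replaceCol, Pi.single_apply,
        Sum.inl.injEq, reduceCtorEq, if_false]
      split_ifs <;> simp_all
    rw [Fintype.sum_sum_type]
    simp_rw [h1, h2, LinearMap.id_apply]
    rw [Fintype.sum_prod_type, Fintype.sum_prod_type, ← Finset.sum_add_distrib]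
    refine Finset.sum_congr rfl fun i _ => ?_
    rw [← Finset.add_sum_erase _ _ (Finset.mem_univ j),
      ← Finset.add_sum_erase (a := j) _ (fun k => l (Pi.single (i, k) 1) ^ 2) (Finset.mem_univ j)]
    simp only [if_true, map_zero]
    rw [add_comm, zero_pow two_ne_zero, zero_add]
    congr 1
    refine Finset.sum_congr rfl fun k hk => ?_
    rw [if_neg (Finset.ne_of_mem_erase hk)])
  rw [LinearMap.id_coe, Measure.map_id] at h
  exact h

lemma lintegral_replaceCol (j : κ) {F : (Fin m × κ → ℝ) → ℝ≥0∞} (hF : Measurable F) :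
    ∫⁻ x, F x ∂stdNormal (Fin m × κ) =
      ∫⁻ x, ∫⁻ g, F (replaceCol j x g) ∂stdNormal (Fin m) ∂stdNormal (Fin m × κ) := by
  conv_lhs => rw [← map_replaceCol_stdNormal (m := m) j]
  rw [lintegral_map hF (measurable_replaceCol j),
    lintegral_prod (fun p => F (replaceCol j p.1 p.2))
      (hF.comp (measurable_replaceCol j)).aemeasurable]

/-- The columns of a matrix given by its entries. -/
def colVec (x : Fin m × κ → ℝ) (k : κ) : Fin m → ℝ := fun i => x (i, k)

lemma colVec_replaceCol_self (j : κ) (x : Fin m × κ → ℝ) (g : Fin m → ℝ) :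
    colVec (replaceCol j x g) j = g := by
  ext i; simp [colVec, replaceCol]

lemma colVec_replaceCol_of_ne {j k : κ} (h : k ≠ j) (x : Fin m × κ → ℝ) (g : Fin m → ℝ) :
    colVec (replaceCol j x g) k = colVec x k := by
  ext i; simp [colVec, replaceCol, h]

lemma measurableSet_linearIndepOn (s : Set κ) :
    MeasurableSet {x : Fin m × κ → ℝ | LinearIndepOn ℝ (colVec x) s} := by
  have h : Continuous fun (x : Fin m × κ → ℝ) (k : s) => colVec x k := by
    unfold colVec; fun_prop
  exact ((isOpen_setOfPred_linearIndependent (𝕜 := ℝ) (E := Fin m → ℝ)).preimage h).measurableSet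

lemma ae_notMem_submodule_stdNormal {ι : Type*} [Fintype ι] (V : Submodule ℝ (ι → ℝ))
    (hV : Module.finrank ℝ V < Fintype.card ι) : ∀ᵐ g ∂stdNormal ι, g ∉ V := by
  have hne : V ≠ ⊤ := by
    rintro rfl
    simp at hV
  have := Measure.addHaar_submodule (volume : Measure (ι → ℝ)) V hne
  exact stdNormal_absolutelyContinuous.ae_le (measure_eq_zero_iff_ae_notMem.1 this)

lemma finrank_span_image_le (f : κ → Fin m → ℝ) (s : Finset κ) :
    Module.finrank ℝ (Submodule.span ℝ (f '' (s : Set κ))) ≤ s.card := by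
  rw [← Finset.coe_image]
  exact (finrank_span_finset_le_card _).trans Finset.card_image_le

/-- By induction on the set of columns: the added column may be resampled, and a fresh Gaussian
vector almost surely avoids the span of fewer than `m` vectors. -/
lemma ae_linearIndepOn_colVec (s : Finset κ) (hs : s.card ≤ m) :
    ∀ᵐ x ∂stdNormal (Fin m × κ), LinearIndepOn ℝ (colVec x) (s : Set κ) := by
  induction s using Finset.induction_on with
  | empty => simp
  | insert j s hj ih =>
    rw [Finset.card_insert_of_notMem hj] at hs
    rw [← map_replaceCol_stdNormal j, ae_map_iff (measurable_replaceCol j).aemeasurable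
      (measurableSet_linearIndepOn _)]
    refine (Measure.ae_prod_iff_ae_ae
      ((measurableSet_linearIndepOn _).preimage (measurable_replaceCol j))).2 ?_
    filter_upwards [ih (by omega)] with x hx
    filter_upwards [ae_notMem_submodule_stdNormal
      (Submodule.span ℝ (colVec x '' (s : Set κ)))
      (by have := finrank_span_image_le (colVec x) s; simp; omega)] with g hg
    rw [Finset.coe_insert, linearIndepOn_insert (by simpa using hj), colVec_replaceCol_self]
    have he : Set.EqOn (colVec (replaceCol j x g)) (colVec x) s := fun k hk =>
      colVec_replaceCol_of_ne (by rintro rfl; exact hj hk) x g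
    exact ⟨hx.congr he.symm, by rwa [he.image_eq]⟩

/-- The matrix with given entries. -/
def ofEntries (x : Fin m × κ → ℝ) : Matrix (Fin m) κ ℝ := Matrix.of fun i k => x (i, k)

lemma isUnit_det_gram_iff (X : Matrix (Fin m) κ ℝ) :
    IsUnit (Xᵀ * X).det ↔ Function.Injective X.mulVec := by
  rw [← Matrix.isUnit_iff_isUnit_det, ← Matrix.mulVec_injective_iff_isUnit]
  have key : ∀ v, (Xᵀ * X) *ᵥ v = 0 ↔ X *ᵥ v = 0 := fun v => by
    refine ⟨fun h => ?_, fun h => by rw [← Matrix.mulVec_mulVec, h, Matrix.mulVec_zero]⟩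
    have : (X *ᵥ v) ⬝ᵥ (X *ᵥ v) = 0 := by
      rw [Matrix.dotProduct_mulVec, Matrix.vecMul_mulVec, ← Matrix.dotProduct_mulVec, h,
        dotProduct_zero]
    exact dotProduct_self_eq_zero.1 this
  change Function.Injective (Xᵀ * X).mulVecLin ↔ Function.Injective X.mulVecLin
  rw [← LinearMap.ker_eq_bot, ← LinearMap.ker_eq_bot, LinearMap.ker_eq_bot', LinearMap.ker_eq_bot']
  simp only [Matrix.mulVecLin_apply, key]

lemma isUnit_det_gram_ofEntries_iff (x : Fin m × κ → ℝ) :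
    IsUnit ((ofEntries x)ᵀ * ofEntries x).det ↔ LinearIndependent ℝ (colVec x) := by
  rw [isUnit_det_gram_iff, Matrix.mulVec_injective_iff]
  rfl

lemma ae_isUnit_det_gram (h : Fintype.card κ ≤ m) :
    ∀ᵐ x ∂stdNormal (Fin m × κ), IsUnit ((ofEntries x)ᵀ * ofEntries x).det := by
  filter_upwards [ae_linearIndepOn_colVec (m := m) (Finset.univ : Finset κ) (by simpa using h)]
    with x hx
  rw [isUnit_det_gram_ofEntries_iff]
  simpa using hx

end ColumnIndependence

/-! ### The diagonal of the mean inverse Wishart matrix. -/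

section InverseGram

/-- The inverse is discontinuous at singular matrices, but the formula adjugate over determinant,
with `0⁻¹ = 0`, is measurable everywhere. -/
lemma measurable_inv_apply {α κ : Type*} [Fintype κ] [DecidableEq κ] [TopologicalSpace α]
    [MeasurableSpace α] [OpensMeasurableSpace α] {M : α → Matrix κ κ ℝ} (hM : Continuous M)
    (i j : κ) : Measurable fun a => (M a)⁻¹ i j := by
  simp only [Matrix.inv_def, Matrix.smul_apply, smul_eq_mul, Ring.inverse_eq_inv']
  exact hM.matrix_det.measurable.inv.mul (hM.matrix_adjugate.matrix_elem i j).measurable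

/-- An orthonormal basis of the orthogonal complement of a subspace, in coordinates. -/
lemma exists_orthonormal_complement {ι : Type*} [Fintype ι] (V : Submodule ℝ (ι → ℝ)) {k : ℕ}
    (hk : Module.finrank ℝ V + k = Fintype.card ι) :
    ∃ b : Fin k → ι → ℝ, (∀ l l', b l ⬝ᵥ b l' = if l = l' then 1 else 0) ∧
      (∀ l, ∀ v ∈ V, b l ⬝ᵥ v = 0) ∧ ∀ g, g - ∑ l, (b l ⬝ᵥ g) • b l ∈ V := by
  classical
  let e := (WithLp.linearEquiv 2 ℝ (ι → ℝ)).symm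
  let W : Submodule ℝ (EuclideanSpace ℝ ι) := V.map e.toLinearMap
  have hW : Module.finrank ℝ W = Module.finrank ℝ V := LinearEquiv.finrank_map_eq e V
  have hWo : Module.finrank ℝ Wᗮ = k := by
    have := W.finrank_add_finrank_orthogonal
    rw [finrank_euclideanSpace] at this
    omega
  let b := (stdOrthonormalBasis ℝ Wᗮ).reindex (finCongr hWo)
  have hin : ∀ u v : EuclideanSpace ℝ ι, u.ofLp ⬝ᵥ v.ofLp = inner ℝ u v := fun u v => by
    rw [EuclideanSpace.inner_eq_star_dotProduct, dotProduct_comm]; simp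
  have hmem : ∀ v : EuclideanSpace ℝ ι, v ∈ W ↔ v.ofLp ∈ V := fun v => by
    simp only [W, Submodule.mem_map]
    constructor
    · rintro ⟨w, hw, rfl⟩; exact hw
    · exact fun h => ⟨v.ofLp, h, rfl⟩
  refine ⟨fun l => ((b l : Wᗮ) : EuclideanSpace ℝ ι).ofLp, fun l l' => ?_, fun l v hv => ?_,
    fun g => ?_⟩
  · rw [hin, ← Submodule.coe_inner, orthonormal_iff_ite.1 b.orthonormal l l']
  · have := (Submodule.mem_orthogonal' W _).1 (b l).2 (WithLp.toLp 2 v) ((hmem _).2 hv)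
    rw [← hin] at this
    exact this
  · have h1 := W.starProjection_add_starProjection_orthogonal (WithLp.toLp 2 g)
    have h2 : Wᗮ.starProjection (WithLp.toLp 2 g) =
        ∑ l, (((b l : Wᗮ) : EuclideanSpace ℝ ι).ofLp ⬝ᵥ g) • ((b l : Wᗮ) : EuclideanSpace ℝ ι) := by
      rw [Submodule.starProjection_apply, b.orthogonalProjectionOnto_apply_eq_sum]
      push_cast
      refine Finset.sum_congr rfl fun l _ => ?_
      rw [← hin]
    have h3 : WithLp.toLp 2 g - Wᗮ.starProjection (WithLp.toLp 2 g) ∈ W := by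
      nth_rewrite 1 [← h1]
      rw [add_sub_cancel_right]
      exact Submodule.starProjection_apply_mem _ _
    rw [hmem, h2] at h3
    simpa using h3

/-- Orthonormality is `B Bᵀ = 1` for the matrix `B` with rows `b l`, so the coordinates have
identity covariance. -/
lemma map_dotProduct_orthonormal {ι : Type*} [Fintype ι] {k : ℕ} (b : Fin k → ι → ℝ)
    (hb : ∀ l l', b l ⬝ᵥ b l' = if l = l' then 1 else 0) :
    (stdNormal ι).map (fun g l => b l ⬝ᵥ g) = stdNormal (Fin k) := by
  classical
  have h := stdNormal_map_eq_map (Matrix.of b).mulVecLin (LinearMap.id : (Fin k → ℝ) →ₗ[ℝ] _)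
    (fun l => by
      have hl : ∀ v : Fin k → ℝ, l v = (fun i => l (Pi.single i 1)) ⬝ᵥ v := fun v => by
        conv_lhs => rw [← Finset.univ_sum_single v]
        rw [map_sum]
        refine Finset.sum_congr rfl fun i _ => ?_
        have : (Pi.single i (v i) : Fin k → ℝ) = v i • Pi.single i 1 := by simp [← Pi.single_smul]
        rw [this, map_smul, smul_eq_mul, mul_comm]
      set a : Fin k → ℝ := fun i => l (Pi.single i 1) with ha
      have h1 : (Matrix.of b) * (Matrix.of b)ᵀ = 1 := by
        ext i j; rw [Matrix.mul_apply, Matrix.one_apply]; exact hb i j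
      calc ∑ i, l ((Matrix.of b).mulVecLin (Pi.single i 1)) ^ 2
          = (a ᵥ* Matrix.of b) ⬝ᵥ (a ᵥ* Matrix.of b) := by
            refine Finset.sum_congr rfl fun i _ => ?_
            rw [hl, Matrix.mulVecLin_apply, Matrix.dotProduct_mulVec]
            simp [sq]
        _ = a ⬝ᵥ a := by
            rw [← Matrix.mulVec_transpose, Matrix.dotProduct_mulVec, Matrix.vecMul_transpose,
              Matrix.mulVec_transpose, ← Matrix.mulVec_transpose, Matrix.mulVec_mulVec, h1,
              Matrix.one_mulVec]
        _ = _ := by simp [dotProduct, sq, ha])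
  rw [LinearMap.id_coe, Measure.map_id] at h
  exact h

variable {m : ℕ} {κ : Type*} [Fintype κ] [DecidableEq κ]

/-- A diagonal entry of the inverse Gram matrix is the inverse of the squared distance from a
column to the span of the others. -/
lemma inv_gram_apply_self (X : Matrix (Fin m) κ ℝ) (hX : IsUnit (Xᵀ * X).det) (j : κ)
    (c : κ → ℝ) (hc : c j = 1) (hu : ∀ k ≠ j, X.col k ⬝ᵥ (X *ᵥ c) = 0) :
    (Xᵀ * X)⁻¹ j j = ((X *ᵥ c) ⬝ᵥ (X *ᵥ c))⁻¹ := by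
  set u := X *ᵥ c with hudef
  -- `u` is the component of column `j` orthogonal to the other columns. Hence `c` solves a Gram
  -- system with right side a multiple of the `j`-th basis vector, and its coordinate `c j = 1`
  -- reads off the entry of the inverse.
  have h1 : (Xᵀ * X) *ᵥ c = (u ⬝ᵥ u) • Pi.single j 1 := by
    rw [← Matrix.mulVec_mulVec]
    have h2 : Xᵀ *ᵥ u = (X.col j ⬝ᵥ u) • Pi.single j 1 := by
      ext k
      by_cases hk : k = j
      · subst hk; simp [Matrix.mulVec, Matrix.col_def]; rfl
      · simp only [Pi.smul_apply, Pi.single_apply, hk, if_false, smul_zero]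
        exact hu k hk
    have h3 : u ⬝ᵥ u = X.col j ⬝ᵥ u := by
      nth_rewrite 1 [hudef]
      rw [dotProduct_comm, Matrix.dotProduct_mulVec, ← Matrix.mulVec_transpose, h2, smul_dotProduct,
        single_dotProduct, hc]
      simp
    rw [h2, h3]
  have h4 : c = (u ⬝ᵥ u) • (Xᵀ * X)⁻¹ *ᵥ Pi.single j 1 := by
    rw [← Matrix.mulVec_smul, ← h1, Matrix.mulVec_mulVec, Matrix.nonsing_inv_mul _ hX,
      Matrix.one_mulVec]
  have h5 := congrFun h4 j
  rw [hc] at h5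
  simp only [Pi.smul_apply, Matrix.mulVec_single_one, smul_eq_mul, Matrix.col_apply] at h5
  exact eq_inv_of_mul_eq_one_right h5.symm

/-- With the other columns frozen, the squared distance from `g` to their span is the sum of squares
of `m - (card κ - 1)` independent standard normal coordinates in the orthogonal complement. The
chi-square mean formula subtracts 2 from this number. -/
lemma lintegral_inv_gram_replaceCol (hm : Fintype.card κ + 1 < m) (j : κ) (x : Fin m × κ → ℝ)
    (hx : LinearIndepOn ℝ (colVec x) (Finset.univ.erase j : Finset κ)) :
    ∫⁻ g, ENNReal.ofReal
        (((ofEntries (replaceCol j x g))ᵀ * ofEntries (replaceCol j x g))⁻¹ j j)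
        ∂stdNormal (Fin m) =
      ENNReal.ofReal (1 / ((m : ℝ) - Fintype.card κ - 1)) := by
  set s : Finset κ := Finset.univ.erase j with hs
  have hcard : s.card + 1 = Fintype.card κ := by
    rw [hs, Finset.card_erase_of_mem (Finset.mem_univ j), Finset.card_univ]
    have := Fintype.card_pos_iff.2 ⟨j⟩
    omega
  set V : Submodule ℝ (Fin m → ℝ) := Submodule.span ℝ (colVec x '' (s : Set κ)) with hV
  have hVr : Module.finrank ℝ V = s.card := by
    rw [hV, Set.image_eq_range]
    exact (finrank_span_eq_card hx).trans (by simp)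
  obtain ⟨b, hb1, hb2, hb3⟩ := exists_orthonormal_complement V (k := m - s.card)
    (by rw [hVr, Fintype.card_fin]; omega)
  have hae : ∀ᵐ g ∂stdNormal (Fin m), ENNReal.ofReal
        (((ofEntries (replaceCol j x g))ᵀ * ofEntries (replaceCol j x g))⁻¹ j j) =
      ENNReal.ofReal (∑ l, (b l ⬝ᵥ g) ^ 2)⁻¹ := by
    filter_upwards [ae_notMem_submodule_stdNormal V (by rw [hVr, Fintype.card_fin]; omega)]
      with g hg
    have he : ∀ k ≠ j, colVec (replaceCol j x g) k = colVec x k := fun k hk =>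
      colVec_replaceCol_of_ne hk x g
    have heq : Set.EqOn (colVec (replaceCol j x g)) (colVec x) s := fun k hk =>
      he k (Finset.ne_of_mem_erase hk)
    have hlin : LinearIndependent ℝ (colVec (replaceCol j x g)) := by
      have h1 : LinearIndepOn ℝ (colVec (replaceCol j x g)) (insert j (s : Set κ)) := by
        rw [linearIndepOn_insert (by simp [hs]), colVec_replaceCol_self, heq.image_eq]
        exact ⟨hx.congr heq.symm, hg⟩
      have h2 : insert j (s : Set κ) = Set.univ := by
        ext k; simp [hs]
      rwa [h2, linearIndepOn_univ_iff] at h1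
    set X := ofEntries (replaceCol j x g) with hXdef
    have hcolX : ∀ k, X.col k = colVec (replaceCol j x g) k := fun k => rfl
    -- Elements of `V` are combinations of the columns other than `j`. The zero coefficient at `j`
    -- gives `Pi.single j 1 - c` the value 1 there.
    have hrange : ∀ v ∈ V, ∃ c : κ → ℝ, c j = 0 ∧ X *ᵥ c = v := by
      have hle : V ≤ (LinearMap.ker (LinearMap.proj j : (κ → ℝ) →ₗ[ℝ] ℝ)).map X.mulVecLin := by
        rw [hV, Submodule.span_le]
        rintro _ ⟨k, hk, rfl⟩
        have hkj := Finset.ne_of_mem_erase hk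
        refine ⟨Pi.single k 1, by simp [hkj], ?_⟩
        rw [Matrix.mulVecLin_apply, Matrix.mulVec_single_one, hcolX, he k hkj]
      intro v hv
      obtain ⟨c, hc, rfl⟩ := hle hv
      exact ⟨c, by simpa using hc, rfl⟩
    obtain ⟨c, hc0, hc⟩ := hrange _ (hb3 g)
    have hXj : X *ᵥ Pi.single j 1 = g := by
      rw [Matrix.mulVec_single_one, hcolX, colVec_replaceCol_self]
    have hu : X *ᵥ (Pi.single j 1 - c) = ∑ l, (b l ⬝ᵥ g) • b l := by
      rw [Matrix.mulVec_sub, hXj, hc, sub_sub_cancel]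
    rw [inv_gram_apply_self X ((isUnit_det_gram_ofEntries_iff _).2 hlin) j (Pi.single j 1 - c)
      (by simp [hc0]) (fun k hk => ?_), hu]
    · congr 2
      simp only [dotProduct_sum, sum_dotProduct, dotProduct_smul, smul_dotProduct, hb1, smul_eq_mul]
      simp [sq]
    · rw [hu, dotProduct_sum]
      refine Finset.sum_eq_zero fun l _ => ?_
      have hmem : X.col k ∈ V := by
        rw [hcolX, he k hk]
        exact Submodule.subset_span ⟨k, by simp [hs, hk], rfl⟩
      rw [dotProduct_smul, dotProduct_comm (X.col k) (b l), hb2 l _ hmem, smul_zero]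
  rw [lintegral_congr_ae hae]
  have h1 := lintegral_inv_sum_sq_stdNormal (ι := Fin (m - s.card)) (by simp; omega)
  rw [← map_dotProduct_orthonormal b hb1, lintegral_map (by fun_prop)
    (by unfold dotProduct; fun_prop)] at h1
  rw [h1, Fintype.card_fin, Nat.cast_sub (by omega), ← hcard]
  push_cast
  congr 2
  ring

lemma continuous_ofEntries : Continuous fun x : Fin m × κ → ℝ => ofEntries x := by
  unfold ofEntries
  exact continuous_matrix fun i j => by simpa using continuous_apply (i, j)

/-- The diagonal of the mean of an inverse Wishart matrix. -/
lemma lintegral_inv_gram (hm : Fintype.card κ + 1 < m) (j : κ) :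
    ∫⁻ x, ENNReal.ofReal (((ofEntries x)ᵀ * ofEntries x)⁻¹ j j) ∂stdNormal (Fin m × κ) =
      ENNReal.ofReal (1 / ((m : ℝ) - Fintype.card κ - 1)) := by
  have hc : Continuous fun x : Fin m × κ → ℝ => (ofEntries x)ᵀ * ofEntries x :=
    continuous_ofEntries.matrix_transpose.matrix_mul continuous_ofEntries
  rw [lintegral_replaceCol j (measurable_inv_apply hc j j).ennreal_ofReal]
  have hle : (Finset.univ.erase j : Finset κ).card ≤ m :=
    (Finset.card_le_univ _).trans (by omega)
  rw [lintegral_congr_ae (g := fun _ => ENNReal.ofReal (1 / ((m : ℝ) - Fintype.card κ - 1)))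
    ((ae_linearIndepOn_colVec _ hle).mono fun x hx => lintegral_inv_gram_replaceCol hm j x hx)]
  simp

end InverseGram

/-! ### Deterministic least squares and the normal equations. -/

section LeastSquares

instance instBorelSpaceMatrix {k l : ℕ} : BorelSpace (Matrix (Fin k) (Fin l) ℝ) :=
  inferInstanceAs (BorelSpace (Fin k → Fin l → ℝ))

lemma sqNorm_eq_dotProduct {k : ℕ} (v : Fin k → ℝ) : sqNorm v = v ⬝ᵥ v := by
  simp [sqNorm, dotProduct, sq]

lemma sqNorm_nonneg {k : ℕ} (v : Fin k → ℝ) : 0 ≤ sqNorm v :=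
  Finset.sum_nonneg fun _ _ => sq_nonneg _

lemma sqNorm_eq_zero {k : ℕ} {v : Fin k → ℝ} : sqNorm v = 0 ↔ v = 0 := by
  rw [sqNorm_eq_dotProduct, dotProduct_self_eq_zero]

/-- The solution of the normal equations. -/
noncomputable def ols {m d : ℕ} (X : Matrix (Fin m) (Fin d) ℝ) (z : Fin m → ℝ) : Fin d → ℝ :=
  (Xᵀ * X)⁻¹ *ᵥ (Xᵀ *ᵥ z)

variable {m d : ℕ} {X : Matrix (Fin m) (Fin d) ℝ}

lemma ols_add (z w : Fin m → ℝ) : ols X (z + w) = ols X z + ols X w := by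
  simp [ols, Matrix.mulVec_add]

lemma ols_smul (c : ℝ) (z : Fin m → ℝ) : ols X (c • z) = c • ols X z := by
  simp [ols, Matrix.mulVec_smul]

lemma ols_neg (z : Fin m → ℝ) : ols X (-z) = -ols X z := by
  simp [ols, Matrix.mulVec_neg]

lemma transpose_mulVec_ols (hX : IsUnit (Xᵀ * X).det) (z : Fin m → ℝ) :
    Xᵀ *ᵥ (X *ᵥ ols X z) = Xᵀ *ᵥ z := by
  rw [Matrix.mulVec_mulVec, ols, Matrix.mulVec_mulVec, Matrix.mul_nonsing_inv _ hX,
    Matrix.one_mulVec]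

lemma ols_mulVec (hX : IsUnit (Xᵀ * X).det) (x : Fin d → ℝ) : ols X (X *ᵥ x) = x := by
  rw [ols, Matrix.mulVec_mulVec _ Xᵀ, Matrix.mulVec_mulVec, Matrix.nonsing_inv_mul _ hX,
    Matrix.one_mulVec]

/-- Equivariance under a change of basis of the columns; it extracts the covariance factor from the
sketched problem. -/
lemma ols_mul (R : Matrix (Fin d) (Fin d) ℝ) (hR : IsUnit R.det)
    (z : Fin m → ℝ) : ols (X * R) z = R⁻¹ *ᵥ ols X z := by
  have hRt : IsUnit (Rᵀ).det := by rwa [Matrix.det_transpose]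
  rw [ols, ols, Matrix.transpose_mul, Matrix.mul_assoc, ← Matrix.mul_assoc Xᵀ,
    Matrix.mul_inv_rev, Matrix.mul_inv_rev, ← Matrix.mulVec_mulVec z, ← Matrix.mulVec_mulVec,
    ← Matrix.mulVec_mulVec, Matrix.mulVec_mulVec _ _ Rᵀ, Matrix.nonsing_inv_mul _ hRt,
    Matrix.one_mulVec]

/-- Pythagoras: the residual of the normal equations is orthogonal to the range of `X`. -/
lemma sqNorm_sub_eq (hX : IsUnit (Xᵀ * X).det) (z : Fin m → ℝ) (w : Fin d → ℝ) :
    sqNorm (X *ᵥ w - z) = sqNorm (X *ᵥ ols X z - z) + sqNorm (X *ᵥ (w - ols X z)) := by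
  have h : (X *ᵥ ols X z - z) ⬝ᵥ (X *ᵥ (w - ols X z)) = 0 := by
    rw [Matrix.dotProduct_mulVec, ← Matrix.mulVec_transpose, Matrix.mulVec_sub,
      transpose_mulVec_ols hX, sub_self, zero_dotProduct]
  have e : X *ᵥ w - z = (X *ᵥ ols X z - z) + X *ᵥ (w - ols X z) := by
    rw [Matrix.mulVec_sub]; abel
  rw [e, sqNorm_eq_dotProduct, add_dotProduct, dotProduct_add, dotProduct_add, h,
    dotProduct_comm (X *ᵥ (w - ols X z)), h, sqNorm_eq_dotProduct, sqNorm_eq_dotProduct]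
  ring

lemma isLeastSquares_iff (hX : IsUnit (Xᵀ * X).det) (z : Fin m → ℝ) (w : Fin d → ℝ) :
    IsLeastSquares X z w ↔ w = ols X z := by
  constructor
  · intro h
    have h1 := h (ols X z)
    rw [sqNorm_sub_eq hX z w] at h1
    have h2 : sqNorm (X *ᵥ (w - ols X z)) = 0 := le_antisymm (by linarith) (sqNorm_nonneg _)
    have h3 := (isUnit_det_gram_iff X).1 hX (a₁ := w - ols X z) (a₂ := 0)
      (by rw [sqNorm_eq_zero.1 h2, Matrix.mulVec_zero])
    exact sub_eq_zero.1 h3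
  · rintro rfl w
    rw [sqNorm_sub_eq hX z w]
    linarith [sqNorm_nonneg (X *ᵥ (w - ols X z))]

lemma existsUnique_isLeastSquares (hX : IsUnit (Xᵀ * X).det) (z : Fin m → ℝ) :
    ∃! x, IsLeastSquares X z x :=
  ⟨ols X z, (isLeastSquares_iff hX z _).2 rfl, fun _ h => (isLeastSquares_iff hX z _).1 h⟩

/-- The default values agree: for a singular Gram matrix a minimizer can be moved along the kernel,
so it is never unique and `lsSol` is 0, and so is `ols` because the inverse of a singular matrix is
0. Hence the estimator has a closed form everywhere, which gives its measurability. -/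
lemma lsSol_eq_ols (X : Matrix (Fin m) (Fin d) ℝ) (z : Fin m → ℝ) : lsSol X z = ols X z := by
  by_cases hX : IsUnit (Xᵀ * X).det
  · have h := existsUnique_isLeastSquares hX z
    rw [lsSol, dif_pos h]
    exact (isLeastSquares_iff hX z _).1 h.choose_spec.1
  · have h : ¬ ∃! x, IsLeastSquares X z x := by
      rintro ⟨x, hx, hu⟩
      refine hX ((isUnit_det_gram_iff X).2 fun a b hab => ?_)
      have hab' : X *ᵥ a = X *ᵥ b := hab
      have := hu (x + (a - b)) fun w => by
        rw [Matrix.mulVec_add, Matrix.mulVec_sub, hab', sub_self, add_zero]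
        exact hx w
      have h2 : a - b = 0 := by simpa using this
      exact sub_eq_zero.1 h2
    rw [lsSol, dif_neg h, ols, Matrix.nonsing_inv_apply_not_isUnit _ hX, Matrix.zero_mulVec]

lemma measurable_ols : Measurable fun p : Matrix (Fin m) (Fin d) ℝ × (Fin m → ℝ) =>
    ols p.1 p.2 := by
  have hc : Continuous fun p : Matrix (Fin m) (Fin d) ℝ × (Fin m → ℝ) => p.1ᵀ * p.1 :=
    continuous_fst.matrix_transpose.matrix_mul continuous_fst
  have hv : Continuous fun p : Matrix (Fin m) (Fin d) ℝ × (Fin m → ℝ) => p.1ᵀ *ᵥ p.2 :=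
    continuous_fst.matrix_transpose.matrix_mulVec continuous_snd
  refine measurable_pi_iff.2 fun j => ?_
  simp only [ols, Matrix.mulVec, dotProduct]
  exact Finset.measurable_sum _ fun i _ => (measurable_inv_apply hc j i).mul
    ((continuous_apply i).comp hv).measurable

lemma measurable_classicalSketch : Measurable (classicalSketch m d) := by
  have : classicalSketch m d = fun p => ols p.1 p.2 := funext fun p => lsSol_eq_ols _ _
  rw [this]; exact measurable_ols

lemma isUnit_det_gram_iff_rank : IsUnit (Xᵀ * X).det ↔ X.rank = d := by
  rw [isUnit_det_gram_iff]
  have h := X.mulVecLin.finrank_range_add_finrank_ker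
  rw [Module.finrank_fin_fun] at h
  change Function.Injective X.mulVecLin ↔ Module.finrank ℝ (LinearMap.range X.mulVecLin) = d
  rw [← LinearMap.ker_eq_bot, ← Submodule.finrank_eq_zero (R := ℝ)]
  omega

lemma transpose_mulVec_residual {n : ℕ} {A : Matrix (Fin n) (Fin d) ℝ} (hA : A.rank = d)
    (y : Fin n → ℝ) : Aᵀ *ᵥ residual A y = 0 := by
  rw [residual, lsSol_eq_ols, Matrix.mulVec_sub,
    transpose_mulVec_ols (isUnit_det_gram_iff_rank.2 hA), sub_self]

lemma mulVec_lsSol_add_residual {n : ℕ} (A : Matrix (Fin n) (Fin d) ℝ) (y : Fin n → ℝ) :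
    A *ᵥ lsSol A y + residual A y = y := by
  rw [residual]; abel

end LeastSquares

/-! ### Second moments of the least squares solution under pure noise. -/

section OlsMoments

variable {m d : ℕ}

lemma ols_apply_eq_dotProduct (X : Matrix (Fin m) (Fin d) ℝ) (z : Fin m → ℝ) (j : Fin d) :
    ols X z j = (X *ᵥ (Xᵀ * X)⁻¹ j) ⬝ᵥ z := by
  rw [ols, Matrix.mulVec, Matrix.dotProduct_mulVec, Matrix.vecMul_transpose]

lemma sum_sq_ols_coef {X : Matrix (Fin m) (Fin d) ℝ} (hX : IsUnit (Xᵀ * X).det) (j : Fin d) :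
    ∑ i, (X *ᵥ (Xᵀ * X)⁻¹ j) i ^ 2 = (Xᵀ * X)⁻¹ j j := by
  have h1 : ((Xᵀ * X)⁻¹)ᵀ = (Xᵀ * X)⁻¹ := by
    rw [Matrix.transpose_nonsing_inv, Matrix.transpose_mul, Matrix.transpose_transpose]
  have h2 : (Xᵀ * X)⁻¹ j = (Xᵀ * X)⁻¹ *ᵥ Pi.single j 1 := by
    rw [Matrix.mulVec_single_one]
    ext i
    rw [Matrix.col_apply]
    exact congrFun (congrFun h1 i) j
  have h3 : ∑ i, (X *ᵥ (Xᵀ * X)⁻¹ j) i ^ 2 =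
      (X *ᵥ (Xᵀ * X)⁻¹ j) ⬝ᵥ (X *ᵥ (Xᵀ * X)⁻¹ j) := by simp [dotProduct, sq]
  rw [h3, Matrix.dotProduct_mulVec, Matrix.vecMul_mulVec, ← Matrix.dotProduct_mulVec, h2, Matrix.mulVec_mulVec,
    Matrix.mul_nonsing_inv _ hX, Matrix.one_mulVec]
  simp

lemma measurable_ofEntries :
    Measurable fun x : Fin m × Fin d → ℝ => (ofEntries x : Matrix (Fin m) (Fin d) ℝ) :=
  continuous_ofEntries.measurable

lemma measurable_ols_ofEntries : Measurable fun p : (Fin m × Fin d → ℝ) × (Fin m → ℝ) =>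
    ols (ofEntries p.1) p.2 := by
  have h1 : Measurable fun p : (Fin m × Fin d → ℝ) × (Fin m → ℝ) =>
      (ofEntries p.1 : Matrix (Fin m) (Fin d) ℝ) := measurable_ofEntries.comp measurable_fst
  have h2 : Measurable fun p : (Fin m × Fin d → ℝ) × (Fin m → ℝ) => p.2 := measurable_snd
  have h := h1.prodMk h2
  have h3 := Measurable.comp measurable_ols h
  exact h3

/-- The mean squared norm of the least squares solution of a pure noise problem. -/
lemma lintegral_sqNorm_ols (hm : d + 1 < m) :
    ∫⁻ p, ENNReal.ofReal (sqNorm (ols (ofEntries p.1) p.2))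
      ∂(stdNormal (Fin m × Fin d)).prod (stdNormal (Fin m)) =
      ENNReal.ofReal ((d : ℝ) / ((m : ℝ) - d - 1)) := by
  have hmj : ∀ j, Measurable fun p : (Fin m × Fin d → ℝ) × (Fin m → ℝ) =>
      ols (ofEntries p.1) p.2 j := fun j =>
    (measurable_pi_apply j).comp measurable_ols_ofEntries
  have hpos : (0 : ℝ) ≤ 1 / ((m : ℝ) - d - 1) := by
    have : (d : ℝ) + 1 < m := by exact_mod_cast hm
    exact one_div_nonneg.2 (by linarith)
  have e : ∀ p : (Fin m × Fin d → ℝ) × (Fin m → ℝ),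
      ENNReal.ofReal (sqNorm (ols (ofEntries p.1) p.2)) =
      ∑ j, ENNReal.ofReal (ols (ofEntries p.1) p.2 j ^ 2) := fun p =>
    ENNReal.ofReal_sum_of_nonneg fun j _ => sq_nonneg _
  simp_rw [e]
  rw [lintegral_finsetSum _ fun j _ => ((hmj j).pow_const 2).ennreal_ofReal]
  have hj : ∀ j, ∫⁻ p, ENNReal.ofReal (ols (ofEntries p.1) p.2 j ^ 2)
      ∂(stdNormal (Fin m × Fin d)).prod (stdNormal (Fin m)) =
      ENNReal.ofReal (1 / ((m : ℝ) - d - 1)) := by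
    intro j
    rw [lintegral_prod _ ((hmj j).pow_const 2).ennreal_ofReal.aemeasurable]
    -- Given the matrix, each coordinate of the solution is linear in the noise. Its variance is the
    -- squared norm of the coefficient vector, a diagonal entry of the inverse Gram matrix.
    have h1 : ∀ᵐ x ∂stdNormal (Fin m × Fin d),
        ∫⁻ g, ENNReal.ofReal (ols (ofEntries x) g j ^ 2) ∂stdNormal (Fin m) =
        ENNReal.ofReal (((ofEntries x)ᵀ * ofEntries x)⁻¹ j j) := by
      filter_upwards [ae_isUnit_det_gram (m := m) (κ := Fin d) (by simp; omega)] with x hx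
      simp_rw [ols_apply_eq_dotProduct]
      obtain ⟨h2, h3⟩ := integrable_sq_dotProduct_stdNormal
        (ofEntries x *ᵥ ((ofEntries x)ᵀ * ofEntries x)⁻¹ j)
      rw [← ofReal_integral_eq_lintegral_ofReal h2 (ae_of_all _ fun _ => sq_nonneg _), h3,
        sum_sq_ols_coef hx]
    rw [lintegral_congr_ae h1]
    simpa using lintegral_inv_gram (m := m) (κ := Fin d) (by simpa using hm) j
  simp_rw [hj]
  rw [Finset.sum_const, Finset.card_univ, Fintype.card_fin, nsmul_eq_mul,
    ← ENNReal.ofReal_natCast, ← ENNReal.ofReal_mul (by positivity)]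
  congr 1
  ring

end OlsMoments

/-! ### The law of the sketched data through Gram matrices. -/

section SketchLaw

open scoped MatrixOrder in
lemma exists_transpose_mul_self_of_posDef {κ : Type*} [Fintype κ] [DecidableEq κ]
    {K : Matrix κ κ ℝ} (hK : K.PosDef) : ∃ R : Matrix κ κ ℝ, IsUnit R.det ∧ Rᵀ * R = K := by
  obtain ⟨R, hR⟩ := CStarAlgebra.nonneg_iff_eq_star_mul_self.mp hK.posSemidef.nonneg
  rw [Matrix.star_eq_conjTranspose, Matrix.conjTranspose_eq_transpose_of_trivial] at hR
  refine ⟨R, ?_, hR.symm⟩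
  have h := (Matrix.isUnit_iff_isUnit_det _).1 hK.isUnit
  rw [hR, Matrix.det_mul] at h
  exact isUnit_of_mul_isUnit_right h

variable {m : ℕ} {κ κ' κ'' : Type*} [Fintype κ] [Fintype κ'] [Fintype κ'']

/-- Right multiplication by a matrix, in terms of entries. -/
def rightMul (m : ℕ) (M : Matrix κ' κ ℝ) : (Fin m × κ' → ℝ) →ₗ[ℝ] (Fin m × κ → ℝ) where
  toFun x p := ∑ k, x (p.1, k) * M k p.2
  map_add' x y := by ext p; simp [add_mul, Finset.sum_add_distrib]
  map_smul' c x := by ext p; simp [Finset.mul_sum, mul_assoc]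

lemma rightMul_apply (M : Matrix κ' κ ℝ) (x : Fin m × κ' → ℝ) (p : Fin m × κ) :
    rightMul m M x p = ∑ k, x (p.1, k) * M k p.2 := rfl

lemma measurable_rightMul (M : Matrix κ' κ ℝ) : Measurable (rightMul m M) :=
  (rightMul m M).continuous_of_finiteDimensional.measurable

lemma rightMul_mul (M : Matrix κ'' κ' ℝ) (N : Matrix κ' κ ℝ) (x : Fin m × κ'' → ℝ) :
    rightMul m (M * N) x = rightMul m N (rightMul m M x) := by
  ext p
  simp only [rightMul_apply, Matrix.mul_apply, Finset.mul_sum, Finset.sum_mul, ← mul_assoc]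
  exact Finset.sum_comm

lemma rightMul_one [DecidableEq κ] (x : Fin m × κ → ℝ) : rightMul m (1 : Matrix κ κ ℝ) x = x := by
  ext p
  simp [rightMul_apply, Matrix.one_apply]

/-- The covariance of `G N` along `l` is a sum over rows of the quadratic form of `Nᵀ N`, and
therefore sees `N` only through its Gram matrix. -/
lemma sum_sq_apply_rightMul [DecidableEq κ] [DecidableEq κ'] (N : Matrix κ' κ ℝ)
    (l : StrongDual ℝ (Fin m × κ → ℝ)) :
    ∑ p, l (rightMul m N (Pi.single p 1)) ^ 2 =
      ∑ i, (fun j => l (Pi.single (i, j) 1)) ⬝ᵥ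
        ((Nᵀ * N) *ᵥ fun j => l (Pi.single (i, j) 1)) := by
  rw [Fintype.sum_prod_type]
  refine Finset.sum_congr rfl fun i _ => ?_
  have h1 : ∀ k, l (rightMul m N (Pi.single (i, k) 1)) =
      (N *ᵥ fun j => l (Pi.single (i, j) 1)) k := by
    intro k
    have : rightMul m N (Pi.single (i, k) 1) = ∑ j, N k j • Pi.single (i, j) (1 : ℝ) := by
      ext ⟨i', j'⟩
      simp only [rightMul_apply, Pi.single_apply, Prod.mk.injEq, Finset.sum_apply,
        Pi.smul_apply, smul_eq_mul]
      by_cases hi : i' = i <;> simp [hi]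
    rw [this, map_sum]
    simp only [map_smul, smul_eq_mul, Matrix.mulVec, dotProduct]
  simp_rw [h1]
  rw [← Matrix.mulVec_mulVec, Matrix.dotProduct_mulVec, Matrix.vecMul_transpose]
  simp [dotProduct, sq]

/-- The law of `G M` depends on `M` only through its Gram matrix. -/
lemma map_rightMul_eq [DecidableEq κ] [DecidableEq κ'] [DecidableEq κ'']
    (M : Matrix κ' κ ℝ) (T : Matrix κ'' κ ℝ) (h : Mᵀ * M = Tᵀ * T) :
    (stdNormal (Fin m × κ')).map (rightMul m M) = (stdNormal (Fin m × κ'')).map (rightMul m T) :=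
  stdNormal_map_eq_map _ _ fun l => by rw [sum_sq_apply_rightMul, sum_sq_apply_rightMul, h]

lemma stdNormal_map_comp_equiv {ι ι' : Type*} [Fintype ι] [Fintype ι'] (e : ι' ≃ ι) :
    (stdNormal ι).map (fun x p => x (e p)) = stdNormal ι' := by
  classical
  have h := stdNormal_map_eq_map (LinearMap.funLeft ℝ ℝ e) (LinearMap.id : (ι' → ℝ) →ₗ[ℝ] _)
    (fun l => by
      rw [← Equiv.sum_comp e]
      refine Finset.sum_congr rfl fun i _ => ?_
      congr 2
      ext k
      simp [LinearMap.funLeft_apply, Pi.single_apply])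
  rw [LinearMap.id_coe, Measure.map_id] at h
  exact h

/-- Separate the last column of a matrix from the others. -/
def splitLast (x : Fin m × (κ ⊕ Unit) → ℝ) : (Fin m × κ → ℝ) × (Fin m → ℝ) :=
  (fun p => x (p.1, .inl p.2), fun i => x (i, .inr ()))

lemma measurable_splitLast :
    Measurable (splitLast : (Fin m × (κ ⊕ Unit) → ℝ) → _) := by
  unfold splitLast; fun_prop

lemma map_splitLast_stdNormal :
    (stdNormal (Fin m × (κ ⊕ Unit))).map splitLast =
      (stdNormal (Fin m × κ)).prod (stdNormal (Fin m)) := by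
  let e : (Fin m × κ) ⊕ Fin m ≃ Fin m × (κ ⊕ Unit) :=
    ((Equiv.prodSumDistrib (Fin m) κ Unit).trans
      (Equiv.sumCongr (Equiv.refl _) (Equiv.prodPUnit (Fin m)))).symm
  rw [← stdNormal_sum, ← stdNormal_map_comp_equiv e, Measure.map_map (by fun_prop) (by fun_prop)]
  rfl

/-- The entries of a matrix. -/
def toEntries (X : Matrix (Fin m) κ ℝ) : Fin m × κ → ℝ := fun p => X p.1 p.2

lemma toEntries_mul (X : Matrix (Fin m) κ' ℝ) (M : Matrix κ' κ ℝ) :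
    toEntries (X * M) = rightMul m M (toEntries X) := by
  ext p; rw [toEntries, Matrix.mul_apply]; rfl

lemma ofEntries_rightMul (x : Fin m × κ' → ℝ) (M : Matrix κ' κ ℝ) :
    (ofEntries (rightMul m M x) : Matrix (Fin m) κ ℝ) = ofEntries x * M := by
  ext i j; rw [Matrix.mul_apply]; rfl

variable {Ω : Type*} [MeasurableSpace Ω] {μ : Measure Ω} [IsProbabilityMeasure μ] {n d : ℕ}
  {S : Ω → Matrix (Fin m) (Fin n) ℝ}

lemma IsGaussianSketch.measurable_toEntries (hS : IsGaussianSketch μ S) :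
    Measurable fun ω => toEntries (S ω) :=
  measurable_pi_iff.2 fun p => hS.measurable p.1 p.2

lemma IsGaussianSketch.map_toEntries (hS : IsGaussianSketch μ S) :
    μ.map (fun ω => toEntries (S ω)) =
      (stdNormal (Fin m × Fin n)).map (fun x => (√(m : ℝ))⁻¹ • x) := by
  have h := hS.indep.map_fun_eq_pi_map
    fun p : Fin m × Fin n => (hS.measurable p.1 p.2).aemeasurable
  refine h.trans ?_
  have h2 := Measure.pi_map_pi (μ := fun _ : Fin m × Fin n => gaussianReal 0 1)
    (f := fun _ x => (√(m : ℝ))⁻¹ * x) (fun _ => by fun_prop)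
  refine Eq.trans ?_ h2.symm
  congr 1
  ext1 p
  rw [hS.law, gaussianReal_map_const_mul, mul_zero, mul_one]
  congr 1
  ext
  simp

/-- The matrix `M` with `n` rows can be traded for any `T`, for instance a square root of the scaled
Gram matrix. The factor `1/m` is the variance of an entry of `S`. -/
lemma IsGaussianSketch.map_toEntries_mul [DecidableEq κ] [DecidableEq κ']
    (hS : IsGaussianSketch μ S) (M : Matrix (Fin n) κ ℝ) (T : Matrix κ' κ ℝ)
    (h : Tᵀ * T = (m : ℝ)⁻¹ • (Mᵀ * M)) :
    μ.map (fun ω => toEntries (S ω * M)) = (stdNormal (Fin m × κ')).map (rightMul m T) := by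
  have e : (fun ω => toEntries (S ω * M)) = rightMul m M ∘ fun ω => toEntries (S ω) :=
    funext fun ω => toEntries_mul _ _
  rw [e, ← Measure.map_map (measurable_rightMul M) hS.measurable_toEntries, hS.map_toEntries,
    Measure.map_map (measurable_rightMul M) (by fun_prop)]
  have e2 : (rightMul m M ∘ fun x => (√(m : ℝ))⁻¹ • x) = rightMul m ((√(m : ℝ))⁻¹ • M) := by
    ext x p
    simp only [Function.comp_apply, Pi.smul_apply, rightMul_apply, Matrix.smul_apply, smul_eq_mul]
    exact Finset.sum_congr rfl fun k _ => by ring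
  rw [e2]
  refine map_rightMul_eq _ _ ?_
  rw [h, Matrix.transpose_smul, Matrix.smul_mul, Matrix.mul_smul, smul_smul, ← mul_inv,
    Real.mul_self_sqrt (Nat.cast_nonneg m)]

/-- The sketched data `(SA, Sr)`, for `r` orthogonal to the range of `A`, have independent
Gaussian components. -/
lemma IsGaussianSketch.map_data (hS : IsGaussianSketch μ S) (A : Matrix (Fin n) (Fin d) ℝ)
    (r : Fin n → ℝ) (hr : Aᵀ *ᵥ r = 0) (R : Matrix (Fin d) (Fin d) ℝ)
    (hR : Rᵀ * R = (m : ℝ)⁻¹ • (Aᵀ * A)) (c : ℝ) (hc : c ^ 2 = (m : ℝ)⁻¹ * sqNorm r) :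
    μ.map (fun ω => (S ω * A, S ω *ᵥ r)) =
      ((stdNormal (Fin m × Fin d)).prod (stdNormal (Fin m))).map
        (fun p => (ofEntries p.1 * R, c • p.2)) := by
  let M : Matrix (Fin n) (Fin d ⊕ Unit) ℝ := Matrix.fromCols A (Matrix.replicateCol Unit r)
  -- Since `r` is orthogonal to the columns of `A`, the Gram matrix of `(A | r)` is block diagonal
  -- and so is this root. Its two blocks act on disjoint, hence independent, columns of the noise.
  let T : Matrix (Fin d ⊕ Unit) (Fin d ⊕ Unit) ℝ :=
    Matrix.fromBlocks R 0 0 (Matrix.of fun _ _ => c)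
  have hT : Tᵀ * T = (m : ℝ)⁻¹ • (Mᵀ * M) := by
    have h1 : Aᵀ * Matrix.replicateCol Unit r = 0 := by
      ext i j
      exact congrFun hr i
    have h2 : (Matrix.replicateCol Unit r)ᵀ * A = 0 := by
      rw [← Matrix.transpose_transpose A, ← Matrix.transpose_mul, h1, Matrix.transpose_zero]
    have h3 : (Matrix.replicateCol Unit r)ᵀ * Matrix.replicateCol Unit r =
        Matrix.of fun _ _ => sqNorm r := by
      ext i j
      simp [Matrix.mul_apply, sqNorm, sq]
    simp only [T, M, Matrix.transpose_fromCols, Matrix.fromRows_mul_fromCols, h1, h2, h3,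
      Matrix.fromBlocks_transpose, Matrix.fromBlocks_multiply, Matrix.fromBlocks_smul, hR,
      Matrix.transpose_zero, Matrix.mul_zero, Matrix.zero_mul, add_zero, zero_add, smul_zero]
    congr 1
    ext i j
    simp [Matrix.mul_apply, ← hc, sq]
  have h := congrArg (Measure.map (fun x : Fin m × (Fin d ⊕ Unit) → ℝ =>
    ((ofEntries (splitLast x).1 : Matrix (Fin m) (Fin d) ℝ), (splitLast x).2)))
    (hS.map_toEntries_mul M T hT)
  have hms : Measurable fun x : Fin m × (Fin d ⊕ Unit) → ℝ =>
    ((ofEntries (splitLast x).1 : Matrix (Fin m) (Fin d) ℝ), (splitLast x).2) :=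
    (measurable_ofEntries.comp (measurable_fst.comp measurable_splitLast)).prodMk
      (measurable_snd.comp measurable_splitLast)
  have hmS : Measurable fun ω => toEntries (S ω * M) := by
    simp_rw [toEntries_mul]
    exact (measurable_rightMul M).comp hS.measurable_toEntries
  rw [Measure.map_map hms hmS, Measure.map_map hms (measurable_rightMul T)] at h
  have hmR : Measurable fun p : (Fin m × Fin d → ℝ) × (Fin m → ℝ) =>
      ((ofEntries p.1 * R : Matrix (Fin m) (Fin d) ℝ), c • p.2) := by
    simp_rw [← ofEntries_rightMul]
    exact (measurable_ofEntries.comp ((measurable_rightMul R).comp measurable_fst)).prodMk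
      (by fun_prop)
  rw [← map_splitLast_stdNormal, Measure.map_map hmR measurable_splitLast]
  have e1 : (fun ω => (S ω * A, S ω *ᵥ r)) =
      (fun x : Fin m × (Fin d ⊕ Unit) → ℝ =>
        ((ofEntries (splitLast x).1 : Matrix (Fin m) (Fin d) ℝ), (splitLast x).2)) ∘
        fun ω => toEntries (S ω * M) := by
    funext ω
    refine Prod.ext (Matrix.ext fun i j => ?_) (funext fun i => ?_)
    · simp [splitLast, ofEntries, toEntries, Matrix.mul_apply, M]
    · simp [splitLast, toEntries, Matrix.mul_apply, M, Matrix.mulVec, dotProduct]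
  have e2 : (fun p : (Fin m × Fin d → ℝ) × (Fin m → ℝ) => (ofEntries p.1 * R, c • p.2)) ∘
      splitLast = (fun x : Fin m × (Fin d ⊕ Unit) → ℝ =>
        ((ofEntries (splitLast x).1 : Matrix (Fin m) (Fin d) ℝ), (splitLast x).2)) ∘
        rightMul m T := by
    funext x
    refine Prod.ext (Matrix.ext fun i j => ?_) (funext fun i => ?_)
    · simp [splitLast, ofEntries, rightMul_apply, Matrix.mul_apply, T]
    · simp [splitLast, rightMul_apply, T, mul_comm]
  rw [e1, e2, h]

end SketchLaw

/-! ### Conditional means as integrals over preimages. -/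

section ConditionalMean

/-- Sets of the pulled-back σ-algebra are preimages under `X`. The right side depends on the joint
law of `X` and `E` only, so it can be moved to another probability space. -/
lemma condExp_comap_ae_eq_const_iff {Ω β F : Type*} [mΩ : MeasurableSpace Ω] [mβ : MeasurableSpace β]
    [NormedAddCommGroup F] [NormedSpace ℝ F] [CompleteSpace F] {μ : Measure Ω}
    [IsProbabilityMeasure μ] {X : Ω → β} (hX : Measurable X) {E : Ω → F} (hE : Integrable E μ)
    (x : F) :
    (μ[E | MeasurableSpace.comap X mβ] =ᵐ[μ] fun _ => x) ↔
      ∀ B, MeasurableSet B → ∫ ω in X ⁻¹' B, (E ω - x) ∂μ = 0 := by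
  have hle : MeasurableSpace.comap X mβ ≤ mΩ := hX.comap_le
  have key : ∀ B, MeasurableSet B → (∫ ω in X ⁻¹' B, (E ω - x) ∂μ = 0 ↔
      ∫ ω in X ⁻¹' B, E ω ∂μ = ∫ _ in X ⁻¹' B, x ∂μ) := fun B _ => by
    rw [integral_sub hE.integrableOn (integrable_const x).integrableOn, sub_eq_zero]
  constructor
  · intro h B hB
    rw [key B hB, ← setIntegral_condExp hle hE ⟨B, hB, rfl⟩]
    exact setIntegral_congr_ae (hX hB) (h.mono fun ω hω _ => hω)
  · intro h
    refine (ae_eq_condExp_of_forall_setIntegral_eq hle hE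
      (fun s _ _ => (integrable_const x).integrableOn) ?_ aestronglyMeasurable_const).symm
    rintro _ ⟨B, hB, rfl⟩ _
    exact ((key B hB).1 (h B hB)).symm

end ConditionalMean

/-! ### The Gaussian model with independent design and noise. -/

section Model

variable {m n d : ℕ}

/-- The law of a Gaussian matrix together with an independent Gaussian vector. -/
noncomputable def noiseLaw (m d : ℕ) : Measure ((Fin m × Fin d → ℝ) × (Fin m → ℝ)) :=
  (stdNormal (Fin m × Fin d)).prod (stdNormal (Fin m))

instance : IsProbabilityMeasure (noiseLaw m d) := by unfold noiseLaw; infer_instance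

lemma ae_noiseLaw_isUnit (hm : d + 1 < m) :
    ∀ᵐ p ∂noiseLaw m d, IsUnit
      ((ofEntries p.1 : Matrix (Fin m) (Fin d) ℝ)ᵀ * (ofEntries p.1)).det := by
  have h := ae_isUnit_det_gram (m := m) (κ := Fin d) (by simp; omega)
  exact Measure.quasiMeasurePreserving_fst.ae h

/-- The sketched data as a function of the noise. -/
def sketchModel (R : Matrix (Fin d) (Fin d) ℝ) (c : ℝ)
    (p : (Fin m × Fin d → ℝ) × (Fin m → ℝ)) : Matrix (Fin m) (Fin d) ℝ × (Fin m → ℝ) :=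
  (ofEntries p.1 * R, c • p.2)

lemma measurable_sketchModel (R : Matrix (Fin d) (Fin d) ℝ) (c : ℝ) :
    Measurable (sketchModel (m := m) R c) := by
  unfold sketchModel
  simp_rw [← ofEntries_rightMul]
  exact (measurable_ofEntries.comp ((measurable_rightMul R).comp measurable_fst)).prodMk
    (by fun_prop)

lemma isUnit_det_gram_mul {G : Matrix (Fin m) (Fin d) ℝ} (hG : IsUnit (Gᵀ * G).det)
    {R : Matrix (Fin d) (Fin d) ℝ} (hR : IsUnit R.det) : IsUnit ((G * R)ᵀ * (G * R)).det := by
  rw [Matrix.transpose_mul, Matrix.mul_assoc, ← Matrix.mul_assoc Gᵀ, Matrix.det_mul,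
    Matrix.det_mul, Matrix.det_transpose]
  exact hR.mul (hG.mul hR)

lemma ols_sketchModel {R : Matrix (Fin d) (Fin d) ℝ} (hR : IsUnit R.det) (c : ℝ)
    (x : Fin d → ℝ) {p : (Fin m × Fin d → ℝ) × (Fin m → ℝ)}
    (hp : IsUnit ((ofEntries p.1 : Matrix (Fin m) (Fin d) ℝ)ᵀ * (ofEntries p.1)).det) :
    ols (sketchModel R c p).1 ((sketchModel R c p).1 *ᵥ x + (sketchModel R c p).2) =
      x + c • R⁻¹ *ᵥ ols (ofEntries p.1) p.2 := by
  simp only [sketchModel]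
  rw [ols_add, ols_mulVec (isUnit_det_gram_mul hp hR), ols_smul, ols_mul R hR]

lemma memLp_ols_noiseLaw (hm : d + 1 < m) (j : Fin d) :
    MemLp (fun p => ols (ofEntries p.1) p.2 j) 2 (noiseLaw m d) := by
  have hmeas : Measurable fun p : (Fin m × Fin d → ℝ) × (Fin m → ℝ) =>
      ols (ofEntries p.1) p.2 j := (measurable_pi_apply j).comp measurable_ols_ofEntries
  rw [memLp_two_iff_integrable_sq hmeas.aestronglyMeasurable]
  refine ⟨(hmeas.pow_const 2).aestronglyMeasurable, ?_⟩
  rw [hasFiniteIntegral_iff_ofReal (ae_of_all _ fun _ => sq_nonneg _)]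
  refine lt_of_le_of_lt (lintegral_mono fun p => ?_)
    ((lintegral_sqNorm_ols hm).trans_lt ENNReal.ofReal_lt_top)
  exact ENNReal.ofReal_le_ofReal (Finset.single_le_sum
    (f := fun j => ols (ofEntries p.1) p.2 j ^ 2) (fun i _ => sq_nonneg _) (Finset.mem_univ j))

lemma integrable_ols_noiseLaw (hm : d + 1 < m) :
    Integrable (fun p => ols (ofEntries p.1) p.2) (noiseLaw m d) :=
  Integrable.of_eval fun j => (memLp_ols_noiseLaw hm j).integrable (by norm_num)

/-- The integrand is odd in the noise vector, while the reflection of that vector preserves the law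
and every set depending on the first component only. -/
lemma setIntegral_ols_noiseLaw (B : Set (Fin m × Fin d → ℝ)) :
    ∫ p in Prod.fst ⁻¹' B, ols (ofEntries p.1) p.2 ∂noiseLaw m d = (0 : Fin d → ℝ) := by
  have hneg : MeasurePreserving (fun g : Fin m → ℝ => -g) (stdNormal (Fin m))
      (stdNormal (Fin m)) := ⟨measurable_neg, stdNormal_map_neg⟩
  have hp : MeasurePreserving (Prod.map id fun g : Fin m → ℝ => -g) (noiseLaw m d)
      (noiseLaw m d) := (MeasurePreserving.id (stdNormal (Fin m × Fin d))).prod hneg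
  have hemb : MeasurableEmbedding
      (Prod.map (id : (Fin m × Fin d → ℝ) → _) fun g : Fin m → ℝ => -g) :=
    ((MeasurableEquiv.refl (Fin m × Fin d → ℝ)).prodCongr
      (MeasurableEquiv.neg (Fin m → ℝ))).measurableEmbedding
  have h := hp.setIntegral_preimage_emb hemb (fun p => ols (ofEntries p.1) p.2) (Prod.fst ⁻¹' B)
  have hs : (Prod.map (id : (Fin m × Fin d → ℝ) → _) fun g : Fin m → ℝ => -g) ⁻¹'
      (Prod.fst ⁻¹' B) = Prod.fst ⁻¹' B := by
    ext p; simp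
  rw [hs] at h
  simp only [Prod.map_fst, Prod.map_snd, id, ols_neg, integral_neg] at h
  exact neg_eq_self.1 h

end Model

/-! ### Transfer between the sketch and the model. -/

section Transfer

variable {m n d : ℕ} {Ω : Type*} [MeasurableSpace Ω] {μ : Measure Ω}
  [IsProbabilityMeasure μ] {S : Ω → Matrix (Fin m) (Fin n) ℝ}

lemma IsGaussianSketch.measurable_mul (hS : IsGaussianSketch μ S)
    (A : Matrix (Fin n) (Fin d) ℝ) : Measurable fun ω => S ω * A := by
  have e : (fun ω => S ω * A) = fun ω => ofEntries (rightMul m A (toEntries (S ω))) := by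
    funext ω
    rw [ofEntries_rightMul]
    rfl
  rw [e]
  exact measurable_ofEntries.comp ((measurable_rightMul A).comp hS.measurable_toEntries)

lemma IsGaussianSketch.measurable_mulVec (hS : IsGaussianSketch μ S) (r : Fin n → ℝ) :
    Measurable fun ω => S ω *ᵥ r := by
  refine measurable_pi_iff.2 fun i => ?_
  simp only [Matrix.mulVec, dotProduct]
  exact Finset.measurable_sum _ fun k _ => (hS.measurable i k).mul_const _

lemma IsGaussianSketch.measurable_data (hS : IsGaussianSketch μ S)
    (A : Matrix (Fin n) (Fin d) ℝ) (r : Fin n → ℝ) :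
    Measurable fun ω => (S ω * A, S ω *ᵥ r) :=
  (hS.measurable_mul A).prodMk (hS.measurable_mulVec r)

lemma estimate_add (f : Estimator m d) (A : Matrix (Fin n) (Fin d) ℝ) (x : Fin d → ℝ)
    (r : Fin n → ℝ) (ω : Ω) :
    estimate S f A (A *ᵥ x + r) ω = f (S ω * A, (S ω * A) *ᵥ x + S ω *ᵥ r) := by
  rw [estimate, Matrix.mulVec_add, Matrix.mulVec_mulVec]

/-- `(R, c)` describes the joint law of the sketch of `A` and of a vector `r`. -/
structure IsModel (m : ℕ) (A : Matrix (Fin n) (Fin d) ℝ) (r : Fin n → ℝ)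
    (R : Matrix (Fin d) (Fin d) ℝ) (c : ℝ) : Prop where
  orth : Aᵀ *ᵥ r = 0
  isUnit : IsUnit R.det
  gram : Rᵀ * R = (m : ℝ)⁻¹ • (Aᵀ * A)
  sq : c ^ 2 = (m : ℝ)⁻¹ * sqNorm r

lemma posDef_smul_transpose_mul_self {κ κ' : Type*} [Fintype κ] [Fintype κ'] [DecidableEq κ]
    {A : Matrix κ' κ ℝ} (hA : Function.Injective A.mulVec) {a : ℝ} (ha : 0 < a) :
    (a • (Aᵀ * A)).PosDef := by
  have h := Matrix.PosDef.conjTranspose_mul_self A hA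
  rw [Matrix.conjTranspose_eq_transpose_of_trivial] at h
  exact h.smul ha

lemma exists_isModel (hm : d + 1 < m) {A : Matrix (Fin n) (Fin d) ℝ} (hA : A.rank = d)
    (y : Fin n → ℝ) : ∃ R c, IsModel m A (residual A y) R c := by
  have hm0 : (0 : ℝ) < (m : ℝ)⁻¹ := inv_pos.2 (by exact_mod_cast (by omega : 0 < m))
  obtain ⟨R, hR, hR2⟩ := exists_transpose_mul_self_of_posDef
    (posDef_smul_transpose_mul_self
      ((isUnit_det_gram_iff A).1 (isUnit_det_gram_iff_rank.2 hA)) hm0)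
  exact ⟨R, √((m : ℝ)⁻¹ * sqNorm (residual A y)), transpose_mulVec_residual hA y, hR, hR2,
    Real.sq_sqrt (mul_nonneg hm0.le (sqNorm_nonneg _))⟩

variable {A : Matrix (Fin n) (Fin d) ℝ} {r : Fin n → ℝ} {R : Matrix (Fin d) (Fin d) ℝ} {c : ℝ}

/-- Both sides are quadratic forms of Gram matrices, and that of `R` is `1/m` times that of `A`. -/
lemma IsModel.sqNorm_mulVec (hM : IsModel m A r R c) (hm : 0 < m) (v : Fin d → ℝ) :
    sqNorm (A *ᵥ v) = m * sqNorm (R *ᵥ v) := by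
  have hm0 : (m : ℝ) ≠ 0 := by positivity
  have h : ∀ {k : ℕ} (N : Matrix (Fin k) (Fin d) ℝ),
      sqNorm (N *ᵥ v) = v ⬝ᵥ ((Nᵀ * N) *ᵥ v) := fun N => by
    rw [sqNorm_eq_dotProduct, ← Matrix.mulVec_mulVec, Matrix.dotProduct_mulVec v,
      Matrix.vecMul_transpose]
  rw [h A, h R, hM.gram, Matrix.smul_mulVec, dotProduct_smul, smul_eq_mul,
    mul_inv_cancel_left₀ hm0]

lemma IsModel.map_data (hM : IsModel m A r R c) (hS : IsGaussianSketch μ S) :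
    μ.map (fun ω => (S ω * A, S ω *ᵥ r)) = (noiseLaw m d).map (sketchModel R c) :=
  hS.map_data A r hM.orth R hM.gram c hM.sq

lemma IsModel.ae_isUnit (hM : IsModel m A r R c) (hS : IsGaussianSketch μ S) (hm : d + 1 < m) :
    ∀ᵐ ω ∂μ, IsUnit ((S ω * A)ᵀ * (S ω * A)).det := by
  have hset : MeasurableSet {q : Matrix (Fin m) (Fin d) ℝ × (Fin m → ℝ) |
      IsUnit (q.1ᵀ * q.1).det} := by
    have hc : Continuous fun q : Matrix (Fin m) (Fin d) ℝ × (Fin m → ℝ) => (q.1ᵀ * q.1).det :=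
      (continuous_fst.matrix_transpose.matrix_mul continuous_fst).matrix_det
    simp_rw [isUnit_iff_ne_zero]
    exact (isOpen_ne.preimage hc).measurableSet
  have h : ∀ᵐ q ∂(noiseLaw m d).map (sketchModel R c), IsUnit (q.1ᵀ * q.1).det := by
    rw [ae_map_iff (measurable_sketchModel R c).aemeasurable hset]
    exact (ae_noiseLaw_isUnit hm).mono fun p hp => isUnit_det_gram_mul hp hM.isUnit
  rw [← hM.map_data hS, ae_map_iff (hS.measurable_data A r).aemeasurable hset] at h
  exact h

lemma IsModel.lintegral_comp (hM : IsModel m A r R c) (hS : IsGaussianSketch μ S)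
    {F : Matrix (Fin m) (Fin d) ℝ × (Fin m → ℝ) → ℝ≥0∞} (hF : Measurable F) :
    ∫⁻ ω, F (S ω * A, S ω *ᵥ r) ∂μ = ∫⁻ p, F (sketchModel R c p) ∂noiseLaw m d := by
  rw [← lintegral_map hF (hS.measurable_data A r), hM.map_data hS,
    lintegral_map hF (measurable_sketchModel R c)]

lemma IsModel.integrable_comp_iff (hM : IsModel m A r R c) (hS : IsGaussianSketch μ S)
    {E : Type*} [NormedAddCommGroup E] [MeasurableSpace E] [BorelSpace E]
    [SecondCountableTopology E]
    {F : Matrix (Fin m) (Fin d) ℝ × (Fin m → ℝ) → E} (hF : Measurable F) :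
    Integrable (fun ω => F (S ω * A, S ω *ᵥ r)) μ ↔
      Integrable (fun p => F (sketchModel R c p)) (noiseLaw m d) := by
  have h1 := integrable_map_measure (μ := μ) (f := fun ω => (S ω * A, S ω *ᵥ r)) (g := F)
    hF.aestronglyMeasurable (hS.measurable_data A r).aemeasurable
  have h2 := integrable_map_measure (μ := noiseLaw m d) (f := sketchModel R c) (g := F)
    hF.aestronglyMeasurable (measurable_sketchModel R c).aemeasurable
  rw [hM.map_data hS] at h1
  exact h1.symm.trans h2

lemma IsModel.setIntegral_comp (hM : IsModel m A r R c) (hS : IsGaussianSketch μ S)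
    {E : Type*} [NormedAddCommGroup E] [NormedSpace ℝ E] [MeasurableSpace E] [BorelSpace E]
    [SecondCountableTopology E]
    {F : Matrix (Fin m) (Fin d) ℝ × (Fin m → ℝ) → E} (hF : Measurable F)
    {B : Set (Matrix (Fin m) (Fin d) ℝ)} (hB : MeasurableSet B) :
    ∫ ω in (fun ω => S ω * A) ⁻¹' B, F (S ω * A, S ω *ᵥ r) ∂μ =
      ∫ p in (fun p => (sketchModel R c p).1) ⁻¹' B, F (sketchModel R c p) ∂noiseLaw m d := by
  have hB' : MeasurableSet ((Prod.fst : Matrix (Fin m) (Fin d) ℝ × (Fin m → ℝ) → _) ⁻¹' B) :=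
    measurable_fst hB
  have h1 := setIntegral_map (μ := μ) hB' hF.aestronglyMeasurable
    (hS.measurable_data A r).aemeasurable
  have h2 := setIntegral_map (μ := noiseLaw m d) hB' hF.aestronglyMeasurable
    (measurable_sketchModel R c).aemeasurable
  rw [hM.map_data hS] at h1
  exact h1.symm.trans h2

end Transfer

/-! ### Unbiasedness and exact error of sketch-and-solve. -/

section ClassicalSketch

variable {m n d : ℕ} {Ω : Type*} [MeasurableSpace Ω] {μ : Measure Ω} [IsProbabilityMeasure μ]
  {S : Ω → Matrix (Fin m) (Fin n) ℝ} {A : Matrix (Fin n) (Fin d) ℝ}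

lemma measurable_shift_comp {F : Type*} [MeasurableSpace F]
    {f : Matrix (Fin m) (Fin d) ℝ × (Fin m → ℝ) → F} (hf : Measurable f) (x : Fin d → ℝ) :
    Measurable fun q : Matrix (Fin m) (Fin d) ℝ × (Fin m → ℝ) => f (q.1, q.1 *ᵥ x + q.2) := by
  have h1 : Measurable fun q : Matrix (Fin m) (Fin d) ℝ × (Fin m → ℝ) => q.1 *ᵥ x + q.2 :=
    ((continuous_fst.matrix_mulVec continuous_const).add continuous_snd).measurable
  exact hf.comp (measurable_fst.prodMk h1)

lemma estimate_classicalSketch_add (x : Fin d → ℝ) (r : Fin n → ℝ) (ω : Ω) :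
    estimate S (classicalSketch m d) A (A *ᵥ x + r) ω =
      ols (S ω * A) ((S ω * A) *ᵥ x + S ω *ᵥ r) := by
  rw [estimate_add, classicalSketch, lsSol_eq_ols]

lemma integrable_estimate_classicalSketch (hS : IsGaussianSketch μ S) (hm : d + 1 < m)
    (hA : A.rank = d) (y : Fin n → ℝ) (x : Fin d → ℝ) :
    Integrable (estimate S (classicalSketch m d) A (A *ᵥ x + residual A y)) μ := by
  obtain ⟨R, c, hM⟩ := exists_isModel hm hA y
  have hF := measurable_shift_comp (measurable_ols (m := m) (d := d)) x
  have e : estimate S (classicalSketch m d) A (A *ᵥ x + residual A y) = fun ω =>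
      ols (S ω * A) ((S ω * A) *ᵥ x + S ω *ᵥ residual A y) :=
    funext fun ω => estimate_classicalSketch_add x _ ω
  rw [e]
  refine (hM.integrable_comp_iff hS hF).2 ?_
  have h1 : Integrable (fun p => x + c • R⁻¹ *ᵥ ols (ofEntries p.1) p.2) (noiseLaw m d) :=
    (integrable_const x).add
      (((Matrix.mulVecLin R⁻¹).toContinuousLinearMap.integrable_comp
        (integrable_ols_noiseLaw hm)).smul c)
  exact h1.congr ((ae_noiseLaw_isUnit hm).mono fun p hp =>
    (ols_sketchModel hM.isUnit c x hp).symm)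

lemma isCondUnbiased_classicalSketch (hS : IsGaussianSketch μ S) (hm : d + 1 < m)
    (hA : A.rank = d) (y : Fin n → ℝ) : IsCondUnbiased μ S A y (classicalSketch m d) := by
  refine ⟨measurable_classicalSketch, fun x =>
    ⟨integrable_estimate_classicalSketch hS hm hA y x, ?_⟩⟩
  obtain ⟨R, c, hM⟩ := exists_isModel hm hA y
  rw [condExp_comap_ae_eq_const_iff (hS.measurable_mul A)
    (integrable_estimate_classicalSketch hS hm hA y x)]
  intro B hB
  have hF : Measurable fun q : Matrix (Fin m) (Fin d) ℝ × (Fin m → ℝ) =>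
      ols q.1 (q.1 *ᵥ x + q.2) - x :=
    (measurable_shift_comp (measurable_ols (m := m) (d := d)) x).sub_const x
  simp_rw [estimate_classicalSketch_add]
  rw [hM.setIntegral_comp hS hF hB]
  set B' : Set (Fin m × Fin d → ℝ) := {g | ofEntries g * R ∈ B} with hB'def
  have hB' : MeasurableSet B' := by
    have h : Measurable fun g : Fin m × Fin d → ℝ =>
        (ofEntries (rightMul m R g) : Matrix (Fin m) (Fin d) ℝ) :=
      measurable_ofEntries.comp (measurable_rightMul R)
    have h2 := h hB
    simp_rw [ofEntries_rightMul] at h2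
    exact h2
  have hpre : (fun p => (sketchModel R c p).1) ⁻¹' B =
      (Prod.fst : (Fin m × Fin d → ℝ) × (Fin m → ℝ) → _) ⁻¹' B' := rfl
  rw [hpre, setIntegral_congr_ae (g := fun p => c • R⁻¹ *ᵥ ols (ofEntries p.1) p.2)
    (measurable_fst hB') ((ae_noiseLaw_isUnit hm).mono fun p hp _ => by
      rw [ols_sketchModel hM.isUnit c x hp, add_sub_cancel_left]), integral_smul]
  have := (Matrix.mulVecLin R⁻¹).toContinuousLinearMap.integral_comp_comm
    (integrable_ols_noiseLaw (m := m) (d := d) hm).integrableOn (μ := (noiseLaw m d).restrict (Prod.fst ⁻¹' B'))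
  rw [setIntegral_ols_noiseLaw, map_zero] at this
  exact (congrArg (c • ·) this).trans (smul_zero c)

/-- The tower property applied to conditional unbiasedness, at `x = x_LS` and for each data pair. -/
lemma isUnbiased_classicalSketch (hS : IsGaussianSketch μ S) (hm : d + 1 < m) :
    IsUnbiased μ S (classicalSketch m d) := by
  refine ⟨measurable_classicalSketch, fun A hA y => ?_⟩
  obtain ⟨h1, h2⟩ := (isCondUnbiased_classicalSketch hS hm hA y).2 (lsSol A y)
  rw [mulVec_lsSol_add_residual] at h1 h2
  refine ⟨h1, ?_⟩
  rw [← integral_condExp (hS.measurable_mul A).comap_le, integral_congr_ae h2]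
  simp

/-- In the model the error vector is `c R⁻¹` applied to the pure noise solution. Measuring it
through `A` is `m` times measuring it through `R`, so `R` cancels and `m c² = ‖y⊥‖²` factors out. -/
lemma predError_classicalSketch (hS : IsGaussianSketch μ S) (hm : d + 1 < m)
    (hA : A.rank = d) (y : Fin n → ℝ) :
    predError μ S (classicalSketch m d) A y = ENNReal.ofReal (errorBound m A y) := by
  obtain ⟨R, c, hM⟩ := exists_isModel hm hA y
  have hm0 : 0 < m := by omega
  have hF : Measurable fun q : Matrix (Fin m) (Fin d) ℝ × (Fin m → ℝ) =>
      ENNReal.ofReal (sqNorm (A *ᵥ (ols q.1 (q.1 *ᵥ lsSol A y + q.2) - lsSol A y))) := by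
    have h1 := (measurable_shift_comp (measurable_ols (m := m) (d := d)) (lsSol A y)).sub_const
      (lsSol A y)
    have h2 : Continuous fun v : Fin d → ℝ => sqNorm (A *ᵥ v) := by
      unfold sqNorm
      exact continuous_finsetSum _ fun i _ =>
        ((continuous_apply i).comp (continuous_const.matrix_mulVec continuous_id)).pow 2
    exact (h2.measurable.comp h1).ennreal_ofReal
  rw [predError]
  have e : ∀ ω, estimate S (classicalSketch m d) A y ω =
      ols (S ω * A) ((S ω * A) *ᵥ lsSol A y + S ω *ᵥ residual A y) := fun ω => by
    rw [← estimate_classicalSketch_add, mulVec_lsSol_add_residual]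
  simp_rw [e]
  rw [hM.lintegral_comp hS hF]
  have h1 : ∀ᵐ p ∂noiseLaw m d, ENNReal.ofReal (sqNorm (A *ᵥ (ols (sketchModel R c p).1
      ((sketchModel R c p).1 *ᵥ lsSol A y + (sketchModel R c p).2) - lsSol A y))) =
      ENNReal.ofReal (sqNorm (residual A y)) *
        ENNReal.ofReal (sqNorm (ols (ofEntries p.1) p.2)) := by
    filter_upwards [ae_noiseLaw_isUnit hm] with p hp
    rw [ols_sketchModel hM.isUnit c _ hp, add_sub_cancel_left, hM.sqNorm_mulVec hm0,
      Matrix.mulVec_smul, Matrix.mulVec_mulVec, Matrix.mul_nonsing_inv _ hM.isUnit,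
      Matrix.one_mulVec, ← ENNReal.ofReal_mul (sqNorm_nonneg _)]
    congr 1
    have : sqNorm (c • ols (ofEntries p.1) p.2) = c ^ 2 * sqNorm (ols (ofEntries p.1) p.2) := by
      simp [sqNorm, mul_pow, Finset.mul_sum]
    rw [this, hM.sq, ← mul_assoc, ← mul_assoc, mul_inv_cancel₀ (by positivity), one_mul]
  rw [lintegral_congr_ae h1, lintegral_const_mul _ ?_, noiseLaw, lintegral_sqNorm_ols hm,
    ← ENNReal.ofReal_mul (sqNorm_nonneg _), errorBound, mul_comm]
  unfold sqNorm
  exact (Finset.measurable_sum _ fun j _ => ((measurable_pi_apply j).comp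
    measurable_ols_ofEntries).pow_const 2).ennreal_ofReal

lemma ae_existsUnique_isLeastSquares (hS : IsGaussianSketch μ S) (hm : d + 1 < m)
    (hA : A.rank = d) (y : Fin n → ℝ) :
    ∀ᵐ ω ∂μ, ∃! x, IsLeastSquares (S ω * A) (S ω *ᵥ y) x := by
  obtain ⟨R, c, hM⟩ := exists_isModel hm hA y
  exact (hM.ae_isUnit hS hm).mono fun ω hω => existsUnique_isLeastSquares hω _

end ClassicalSketch

/-! ### Signed densities and uniqueness of their Laplace transforms. -/

section SignedDensity

variable {V β : Type*} [MeasurableSpace V] [MeasurableSpace β] {P : Measure V} {F : V → ℝ}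

lemma integrable_max_zero_mul {h : V → ℝ} (hF : AEStronglyMeasurable F P)
    (hh : AEStronglyMeasurable h P) (hi : Integrable (fun v => F v * h v) P) :
    Integrable (fun v => max (F v) 0 * h v) P := by
  refine hi.mono ((hF.sup aestronglyMeasurable_const).mul hh) (ae_of_all _ fun v => ?_)
  rw [norm_mul, norm_mul, Real.norm_eq_abs, Real.norm_eq_abs, Real.norm_eq_abs]
  refine mul_le_mul_of_nonneg_right ?_ (abs_nonneg _)
  rw [abs_of_nonneg (le_max_right _ _)]
  exact max_le (le_abs_self _) (abs_nonneg _)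

lemma integrable_withDensity_ofReal {h : V → ℝ} (hF : Measurable F)
    (hh : AEStronglyMeasurable h P) (hi : Integrable (fun v => F v * h v) P) :
    Integrable h (P.withDensity fun v => ENNReal.ofReal (F v)) := by
  rw [integrable_withDensity_iff_integrable_smul' hF.ennreal_ofReal
    (ae_of_all _ fun _ => ENNReal.ofReal_lt_top)]
  simpa only [ENNReal.toReal_ofReal', smul_eq_mul] using
    integrable_max_zero_mul hF.aestronglyMeasurable hh hi

lemma integral_withDensity_ofReal (h : V → ℝ) (hF : Measurable F) :
    ∫ v, h v ∂(P.withDensity fun v => ENNReal.ofReal (F v)) = ∫ v, max (F v) 0 * h v ∂P := by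
  rw [integral_withDensity_eq_integral_toReal_smul hF.ennreal_ofReal
    (ae_of_all _ fun _ => ENNReal.ofReal_lt_top)]
  simp only [ENNReal.toReal_ofReal', smul_eq_mul]

/-- Integration against a signed density is the difference of the integrals against its positive
and negative parts. -/
lemma integral_withDensity_sub {h : V → ℝ} (hF : Measurable F)
    (hh : AEStronglyMeasurable h P) (hi : Integrable (fun v => F v * h v) P) :
    ∫ v, h v ∂(P.withDensity fun v => ENNReal.ofReal (F v)) -
      ∫ v, h v ∂(P.withDensity fun v => ENNReal.ofReal (-F v)) = ∫ v, F v * h v ∂P := by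
  have hn : Integrable (fun v => -F v * h v) P := hi.neg.congr (ae_of_all _ fun v => by simp)
  rw [integral_withDensity_ofReal h hF, integral_withDensity_ofReal (F := fun v => -F v) h hF.neg,
    ← integral_sub (integrable_max_zero_mul hF.aestronglyMeasurable hh hi)
      (integrable_max_zero_mul (F := fun v => -F v) hF.neg.aestronglyMeasurable hh hn)]
  refine integral_congr_ae (ae_of_all _ fun v => ?_)
  simp only [← sub_mul]
  congr 1
  have := max_zero_sub_eq_self (F v)
  rwa [max_comm, max_comm 0] at this

lemma isFiniteMeasure_withDensity_ofReal_of_integrable (hi : Integrable F P) :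
    IsFiniteMeasure (P.withDensity fun v => ENNReal.ofReal (F v)) :=
  isFiniteMeasure_withDensity_ofReal hi.2

/-- `Y` has the same law under the positive and the negative part of the density `F`. -/
def SameSignedLaw (P : Measure V) (F : V → ℝ) (Y : V → β) : Prop :=
  (P.withDensity fun v => ENNReal.ofReal (F v)).map Y =
    (P.withDensity fun v => ENNReal.ofReal (-F v)).map Y

/-- `SameSignedLaw` expresses that `F` has conditional mean zero given `Y`. Being an equality of
measures, it applies to unbounded `h` as soon as the product is integrable. -/
lemma SameSignedLaw.integral_eq_zero {Y : V → β} (hs : SameSignedLaw P F Y) (hF : Measurable F)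
    (hY : Measurable Y) {h : β → ℝ} (hh : Measurable h)
    (hi : Integrable (fun v => F v * h (Y v)) P) : ∫ v, F v * h (Y v) ∂P = 0 := by
  rw [← integral_withDensity_sub (h := fun v => h (Y v)) hF (hh.comp hY).aestronglyMeasurable hi,
    sub_eq_zero]
  rw [← integral_map hY.aemeasurable hh.aestronglyMeasurable,
    ← integral_map hY.aemeasurable hh.aestronglyMeasurable, hs]

lemma sameSignedLaw_of_setIntegral {Y : V → β} (hF : Measurable F) (hi : Integrable F P)
    (hY : Measurable Y) (h : ∀ B, MeasurableSet B → ∫ v in Y ⁻¹' B, F v ∂P = 0) :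
    SameSignedLaw P F Y := by
  have := isFiniteMeasure_withDensity_ofReal_of_integrable hi
  have := isFiniteMeasure_withDensity_ofReal_of_integrable hi.neg
  ext B hB
  rw [Measure.map_apply hY hB, Measure.map_apply hY hB]
  have e : (fun v => F v * (Y ⁻¹' B).indicator (fun _ => (1 : ℝ)) v) = (Y ⁻¹' B).indicator F := by
    ext v; by_cases hv : v ∈ Y ⁻¹' B <;> simp [hv]
  have h1 := integral_withDensity_sub (P := P) (h := (Y ⁻¹' B).indicator fun _ => 1) hF
    ((measurable_const.indicator (hY hB)).aestronglyMeasurable)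
    (by rw [e]; exact hi.indicator (hY hB))
  rw [e, integral_indicator (f := F) (hY hB), h B hB, integral_indicator_const _ (hY hB),
    integral_indicator_const _ (hY hB), smul_eq_mul, smul_eq_mul, mul_one, mul_one,
    sub_eq_zero] at h1
  exact (measureReal_eq_measureReal_iff).1 h1

/-- Uniqueness of the Laplace transform near the origin, for a signed density. -/
lemma sameSignedLaw_of_exp {Y : V → ℝ} (hF : Measurable F) (hY : Measurable Y) {ε : ℝ}
    (hε : 0 < ε) (h : ∀ t, |t| < ε → Integrable (fun v => F v * Real.exp (t * Y v)) P ∧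
      ∫ v, F v * Real.exp (t * Y v) ∂P = 0) :
    SameSignedLaw P F Y := by
  have hi : Integrable F P := by simpa using (h 0 (by simpa using hε)).1
  have hm : ∀ t, AEStronglyMeasurable (fun v => Real.exp (t * Y v)) P := fun t =>
    (hY.const_mul t).exp.aestronglyMeasurable
  set ν := P.withDensity fun v => ENNReal.ofReal (F v) with hν
  set ν' := P.withDensity fun v => ENNReal.ofReal (-F v) with hν'
  have : IsFiniteMeasure ν := isFiniteMeasure_withDensity_ofReal_of_integrable hi
  have : IsFiniteMeasure ν' := isFiniteMeasure_withDensity_ofReal_of_integrable hi.neg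
  -- Exponential integrability on the interval makes both complex moment generating functions
  -- analytic on the vertical strip above it.
  have hsub : Set.Ioo (-ε) ε ⊆ interior (integrableExpSet Y ν) :=
    interior_maximal (fun t ht => integrable_withDensity_ofReal hF (hm t)
      (h t (abs_lt.2 ht)).1) isOpen_Ioo
  have hsub' : Set.Ioo (-ε) ε ⊆ interior (integrableExpSet Y ν') :=
    interior_maximal (fun t ht => integrable_withDensity_ofReal hF.neg (hm t)
      ((h t (abs_lt.2 ht)).1.neg.congr (ae_of_all _ fun v => by simp))) isOpen_Ioo
  have hmgf : ∀ t ∈ Set.Ioo (-ε) ε, mgf Y ν t = mgf Y ν' t := fun t ht => by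
    have h1 := h t (abs_lt.2 ht)
    have h2 := integral_withDensity_sub hF (hm t) h1.1
    rw [h1.2, sub_eq_zero] at h2
    exact h2
  have hA : AnalyticOnNhd ℂ (complexMGF Y ν) {z | z.re ∈ Set.Ioo (-ε) ε} :=
    analyticOnNhd_complexMGF.mono fun z hz => hsub hz
  have hA' : AnalyticOnNhd ℂ (complexMGF Y ν') {z | z.re ∈ Set.Ioo (-ε) ε} :=
    analyticOnNhd_complexMGF.mono fun z hz => hsub' hz
  -- The functions agree on the real interval, which accumulates at 0, so the identity theorem gives
  -- agreement on the strip. The strip contains the imaginary axis, where they are characteristic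
  -- functions.
  have heq : Set.EqOn (complexMGF Y ν) (complexMGF Y ν') {z | z.re ∈ Set.Ioo (-ε) ε} := by
    refine AnalyticOnNhd.eqOn_of_preconnected_of_frequently_eq hA hA'
      ((convex_Ioo (-ε) ε).linear_preimage Complex.reLm).isPreconnected
      (z₀ := 0) (by simp [hε]) ?_
    have hreal : ∃ᶠ x : ℝ in nhdsWithin 0 {0}ᶜ, complexMGF Y ν x = complexMGF Y ν' x := by
      refine Filter.Eventually.frequently (nhdsWithin_le_nhds ?_)
      filter_upwards [Ioo_mem_nhds (neg_neg_of_pos hε) hε] with t ht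
      rw [complexMGF_ofReal, complexMGF_ofReal, hmgf t ht]
    rw [Filter.frequently_iff_seq_forall] at hreal ⊢
    obtain ⟨xs, hx, hx'⟩ := hreal
    refine ⟨fun n => xs n, ?_, hx'⟩
    rw [tendsto_nhdsWithin_iff] at hx ⊢
    exact ⟨(Complex.continuous_ofReal.tendsto 0).comp hx.1, by simpa using hx.2⟩
  refine Measure.ext_of_charFun (funext fun t => ?_)
  rw [← complexMGF_mul_I hY.aemeasurable, ← complexMGF_mul_I hY.aemeasurable]
  exact heq (by simp [hε])

end SignedDensity

/-! ### Random Gaussian shifts and the score identity. -/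

section GaussianShift

variable {α ι : Type*} [MeasurableSpace α] [Fintype ι] {ρ : Measure α} [SFinite ρ]

/-- The Cameron–Martin formula for a shift depending on an independent variable. -/
lemma map_prod_stdNormal_shift {v : α → ι → ℝ} (hv : Measurable v) :
    (ρ.prod (stdNormal ι)).map (fun p => (p.1, p.2 + v p.1)) =
      (ρ.prod (stdNormal ι)).withDensity (fun p =>
        ENNReal.ofReal (Real.exp (∑ i, p.2 i * v p.1 i - (∑ i, v p.1 i ^ 2) / 2))) := by
  have hshift : Measurable fun p : α × (ι → ℝ) => (p.1, p.2 + v p.1) := by fun_prop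
  have hvi : ∀ i, Measurable fun p : α × (ι → ℝ) => v p.1 i := fun i =>
    (measurable_pi_apply i).comp (hv.comp measurable_fst)
  have hw : Measurable fun p : α × (ι → ℝ) =>
      ENNReal.ofReal (Real.exp (∑ i, p.2 i * v p.1 i - (∑ i, v p.1 i ^ 2) / 2)) := by fun_prop
  refine Measure.ext_of_lintegral _ fun f hf => ?_
  rw [lintegral_map hf hshift, lintegral_withDensity_eq_lintegral_mul _ hw hf,
    lintegral_prod (fun p : α × (ι → ℝ) => f (p.1, p.2 + v p.1)) (hf.comp hshift).aemeasurable, lintegral_prod _ (hw.mul hf).aemeasurable]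
  refine lintegral_congr fun a => ?_
  have hfa : Measurable fun g => f (a, g) := hf.comp measurable_prodMk_left
  have h1 := lintegral_map (μ := stdNormal ι) hfa (measurable_add_const (v a))
  rw [stdNormal_map_add, lintegral_withDensity_eq_lintegral_mul _ (by fun_prop) hfa] at h1
  exact h1.symm

/-- If `D` has mean zero conditionally on the first variable after every Gaussian shift in the
direction `u`, then it is conditionally uncorrelated with the score `⟨g, u⟩`. -/
lemma integral_mul_score_eq_zero {u : α → ι → ℝ} (hu : Measurable u) {D : α × (ι → ℝ) → ℝ}
    (hD : Measurable D)
    (hint : ∀ t : ℝ, Integrable (fun p => D (p.1, p.2 + t • u p.1)) (ρ.prod (stdNormal ι)))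
    (hzero : ∀ (t : ℝ) (B : Set α), MeasurableSet B →
      ∫ p in Prod.fst ⁻¹' B, D (p.1, p.2 + t • u p.1) ∂ρ.prod (stdNormal ι) = 0)
    {h : α → ℝ} (hh : Measurable h) {C : ℝ} (hC : ∀ a, |h a| ≤ C)
    (hsupp : ∀ a, h a ≠ 0 → ∑ i, u a i ^ 2 ≤ C) :
    Integrable (fun p => D p * h p.1 * (u p.1 ⬝ᵥ p.2)) (ρ.prod (stdNormal ι)) ∧
      ∫ p, D p * h p.1 * (u p.1 ⬝ᵥ p.2) ∂ρ.prod (stdNormal ι) = 0 := by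
  set P := ρ.prod (stdNormal ι) with hP
  have hui : ∀ i, Measurable fun a => u a i := fun i => (measurable_pi_apply i).comp hu
  have hui' : ∀ i, Measurable fun p : α × (ι → ℝ) => u p.1 i := fun i =>
    (hui i).comp measurable_fst
  have hY : Measurable fun p : α × (ι → ℝ) => u p.1 ⬝ᵥ p.2 := by
    unfold dotProduct; fun_prop
  have hC0 : ∀ a, 0 ≤ C := fun a => (abs_nonneg _).trans (hC a)
  have key : ∀ t : ℝ, Integrable (fun p => D p * h p.1 * Real.exp (t * (u p.1 ⬝ᵥ p.2))) P ∧
      ∫ p, D p * h p.1 * Real.exp (t * (u p.1 ⬝ᵥ p.2)) ∂P = 0 := by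
    intro t
    have hshift : Measurable fun p : α × (ι → ℝ) => (p.1, p.2 + t • u p.1) := by fun_prop
    -- The extra exponential cancels the normalizing factor of the Cameron–Martin density, leaving
    -- the pure tilt `exp(t⟨u, g⟩)`. It stays bounded because `u` is bounded where `h` is nonzero.
    let k : α → ℝ := fun a => h a * Real.exp (t ^ 2 * (∑ i, u a i ^ 2) / 2)
    have hk : Measurable k := by fun_prop
    have hkb : ∀ a, ‖k a‖ ≤ C * Real.exp (t ^ 2 * C / 2) := by
      intro a
      rw [Real.norm_eq_abs, abs_mul, Real.abs_exp]
      by_cases ha : h a = 0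
      · rw [ha, abs_zero, zero_mul]
        have := hC0 a
        positivity
      · refine mul_le_mul (hC a) (Real.exp_le_exp.2 ?_) (Real.exp_pos _).le (hC0 a)
        have := mul_le_mul_of_nonneg_left (hsupp a ha) (sq_nonneg t)
        linarith
    have hDs : Measurable fun p : α × (ι → ℝ) => D (p.1, p.2 + t • u p.1) := hD.comp hshift
    have hi1 : Integrable (fun p => D (p.1, p.2 + t • u p.1) * k p.1) P :=
      (hint t).mul_bdd (c := C * Real.exp (t ^ 2 * C / 2))
        (hk.comp measurable_fst).aestronglyMeasurable (ae_of_all _ fun p => hkb p.1)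
    have hz1 : ∫ p, D (p.1, p.2 + t • u p.1) * k p.1 ∂P = 0 :=
      (sameSignedLaw_of_setIntegral hDs (hint t) measurable_fst (hzero t)).integral_eq_zero
        hDs measurable_fst hk hi1
    have hΦ : Measurable fun q : α × (ι → ℝ) => D q * k q.1 :=
      hD.mul (hk.comp measurable_fst)
    have hcm := map_prod_stdNormal_shift (ρ := ρ) (hu.const_smul t)
    have hw : Measurable fun p : α × (ι → ℝ) => Real.exp
        (∑ i, p.2 i * (t • u) p.1 i - (∑ i, (t • u) p.1 i ^ 2) / 2) := by
      simp only [Pi.smul_apply, smul_eq_mul]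
      fun_prop
    have e : ∀ p : α × (ι → ℝ), (ENNReal.ofReal (Real.exp
        (∑ i, p.2 i * (t • u) p.1 i - (∑ i, (t • u) p.1 i ^ 2) / 2))).toReal • (D p * k p.1) =
        D p * h p.1 * Real.exp (t * (u p.1 ⬝ᵥ p.2)) := by
      intro p
      rw [ENNReal.toReal_ofReal (Real.exp_pos _).le, smul_eq_mul]
      have e1 : ∑ i, p.2 i * (t • u) p.1 i - (∑ i, (t • u) p.1 i ^ 2) / 2 =
          t * (u p.1 ⬝ᵥ p.2) - t ^ 2 * (∑ i, u p.1 i ^ 2) / 2 := by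
        simp only [Pi.smul_apply, smul_eq_mul, mul_pow, ← Finset.mul_sum, dotProduct]
        congr 1
        rw [Finset.mul_sum]
        exact Finset.sum_congr rfl fun i _ => by ring
      rw [e1, Real.exp_sub]
      simp only [k]
      field_simp
    constructor
    · have h1 := (integrable_map_measure (μ := P) (f := fun p => (p.1, p.2 + (t • u) p.1))
        (g := fun q => D q * k q.1) hΦ.aestronglyMeasurable (by fun_prop)).2 hi1
      rw [hcm, integrable_withDensity_iff_integrable_smul' hw.ennreal_ofReal
        (ae_of_all _ fun _ => ENNReal.ofReal_lt_top)] at h1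
      exact h1.congr (ae_of_all _ e)
    · have h1 := integral_map (μ := P) (φ := fun p => (p.1, p.2 + (t • u) p.1))
        (f := fun q => D q * k q.1) (by fun_prop) hΦ.aestronglyMeasurable
      rw [hcm, integral_withDensity_eq_integral_toReal_smul hw.ennreal_ofReal
        (ae_of_all _ fun _ => ENNReal.ofReal_lt_top), integral_congr_ae (ae_of_all _ e)] at h1
      exact h1.trans hz1
  have hFm : Measurable fun p : α × (ι → ℝ) => D p * h p.1 := hD.mul (hh.comp measurable_fst)
  -- From `|s| ≤ exp s + exp (-s)`, the tilts at `t = 1` and `t = -1` dominate the score.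
  have hI : Integrable (fun p => D p * h p.1 * (u p.1 ⬝ᵥ p.2)) P := by
    refine ((key 1).1.abs.add (key (-1)).1.abs).mono' (hFm.mul hY).aestronglyMeasurable
      (ae_of_all _ fun p => ?_)
    simp only [Pi.add_apply]
    rw [Real.norm_eq_abs, abs_mul, abs_mul (D p * h p.1), abs_mul (D p * h p.1), Real.abs_exp,
      Real.abs_exp, ← mul_add]
    refine mul_le_mul_of_nonneg_left ?_ (abs_nonneg _)
    have h1 := Real.add_one_le_exp (1 * (u p.1 ⬝ᵥ p.2))
    have h2 := Real.add_one_le_exp (-1 * (u p.1 ⬝ᵥ p.2))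
    have h3 := Real.exp_pos (1 * (u p.1 ⬝ᵥ p.2))
    have h4 := Real.exp_pos (-1 * (u p.1 ⬝ᵥ p.2))
    exact abs_le.2 ⟨by linarith, by linarith⟩
  exact ⟨hI, (sameSignedLaw_of_exp hFm hY one_pos fun t _ => key t).integral_eq_zero hFm hY
    measurable_id hI⟩

end GaussianShift

/-! ### Reduction of the lower bound to vanishing covariances. -/

section LowerBound

variable {m n d : ℕ} {Ω : Type*} [MeasurableSpace Ω] {μ : Measure Ω} [IsProbabilityMeasure μ]
  {S : Ω → Matrix (Fin m) (Fin n) ℝ} {A : Matrix (Fin n) (Fin d) ℝ}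

lemma IsGaussianSketch.measurable_estimate (hS : IsGaussianSketch μ S) {f : Estimator m d}
    (hf : Measurable f) (A : Matrix (Fin n) (Fin d) ℝ) (y : Fin n → ℝ) :
    Measurable (estimate S f A y) := hf.comp (hS.measurable_data A y)

lemma integrable_sqNorm_of_lintegral {k : ℕ} {v : Ω → Fin k → ℝ} (hv : Measurable v)
    (h : ∫⁻ ω, ENNReal.ofReal (sqNorm (v ω)) ∂μ ≠ ⊤) :
    Integrable (fun ω => sqNorm (v ω)) μ ∧ ∀ i, MemLp (fun ω => v ω i) 2 μ := by
  have hvi : ∀ i, Measurable fun ω => v ω i := fun i => (measurable_pi_apply i).comp hv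
  have hI : Integrable (fun ω => sqNorm (v ω)) μ := by
    refine ⟨?_, ?_⟩
    · unfold sqNorm; fun_prop
    · rw [hasFiniteIntegral_iff_ofReal (ae_of_all _ fun _ => sqNorm_nonneg _)]
      exact h.lt_top
  refine ⟨hI, fun i => ?_⟩
  rw [memLp_two_iff_integrable_sq (hvi i).aestronglyMeasurable]
  refine hI.mono' ((hvi i).pow_const 2).aestronglyMeasurable (ae_of_all _ fun ω => ?_)
  rw [Real.norm_of_nonneg (sq_nonneg _)]
  exact Finset.single_le_sum (f := fun i => v ω i ^ 2) (fun i _ => sq_nonneg _)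
    (Finset.mem_univ i)

lemma memLp_of_memLp_mulVec (hA : A.rank = d) {v : Ω → Fin d → ℝ}
    (h : ∀ i, MemLp (fun ω => (A *ᵥ v ω) i) 2 μ) (j : Fin d) : MemLp (fun ω => v ω j) 2 μ := by
  have e : (fun ω => v ω j) = fun ω => ∑ i, ((Aᵀ * A)⁻¹ * Aᵀ) j i * (A *ᵥ v ω) i := by
    funext ω
    have h1 : ((Aᵀ * A)⁻¹ * Aᵀ) *ᵥ (A *ᵥ v ω) = v ω := by
      rw [← Matrix.mulVec_mulVec]
      exact ols_mulVec (isUnit_det_gram_iff_rank.2 hA) _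
    exact (congrFun h1 j).symm
  rw [e]
  exact memLp_finsetSum _ fun i _ => (h i).const_mul _

/-- Expansion of the square with `‖A u‖²` dropped. The cross term is written in coordinates so that
only scalar covariances are needed. -/
lemma sqNorm_mulVec_add (A : Matrix (Fin n) (Fin d) ℝ) (u v : Fin d → ℝ) :
    2 * ∑ j, ∑ l, (Aᵀ * A) j l * (u j * v l) + sqNorm (A *ᵥ v) ≤ sqNorm (A *ᵥ (u + v)) := by
  have h1 : ∑ j, ∑ l, (Aᵀ * A) j l * (u j * v l) = (A *ᵥ u) ⬝ᵥ (A *ᵥ v) := by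
    rw [dotProduct_comm, Matrix.dotProduct_mulVec, Matrix.vecMul_mulVec, dotProduct_comm,
      dotProduct]
    refine Finset.sum_congr rfl fun j _ => ?_
    rw [← Matrix.mulVec_transpose, Matrix.transpose_mul, Matrix.transpose_transpose,
      Matrix.mulVec, dotProduct, Finset.mul_sum]
    exact Finset.sum_congr rfl fun l _ => by ring
  rw [h1, Matrix.mulVec_add, sqNorm_eq_dotProduct (_ + _), add_dotProduct, dotProduct_add,
    dotProduct_add, ← sqNorm_eq_dotProduct, ← sqNorm_eq_dotProduct,
    dotProduct_comm (A *ᵥ v) (A *ᵥ u)]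
  linarith [sqNorm_nonneg (A *ᵥ u)]

lemma integral_sum_mul_eq_zero (a : Fin d → Fin d → ℝ) {φ : Fin d → Fin d → Ω → ℝ}
    (hi : ∀ j l, Integrable (φ j l) μ) (hz : ∀ j l, ∫ ω, φ j l ω ∂μ = 0) :
    Integrable (fun ω => ∑ j, ∑ l, a j l * φ j l ω) μ ∧
      ∫ ω, ∑ j, ∑ l, a j l * φ j l ω ∂μ = 0 := by
  have h1 : ∀ j, Integrable (fun ω => ∑ l, a j l * φ j l ω) μ := fun j =>
    integrable_finsetSum _ fun l _ => (hi j l).const_mul _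
  refine ⟨integrable_finsetSum _ fun j _ => h1 j, ?_⟩
  rw [integral_finsetSum _ fun j _ => h1 j]
  refine Finset.sum_eq_zero fun j _ => ?_
  rw [integral_finsetSum _ fun l _ => (hi j l).const_mul _]
  refine Finset.sum_eq_zero fun l _ => ?_
  rw [integral_const_mul, hz, mul_zero]

/-- An estimator whose difference to the least squares estimator is uncorrelated with the latter
has at least its prediction error. -/
lemma errorBound_le_predError (hS : IsGaussianSketch μ S) (hm : d + 1 < m) (hA : A.rank = d)
    (y : Fin n → ℝ) {f : Estimator m d} (hf : Measurable f)
    (h : ∀ j l, Integrable (fun ω => (estimate S f A y ω j -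
        estimate S (classicalSketch m d) A y ω j) *
        (estimate S (classicalSketch m d) A y ω l - lsSol A y l)) μ →
      ∫ ω, (estimate S f A y ω j - estimate S (classicalSketch m d) A y ω j) *
        (estimate S (classicalSketch m d) A y ω l - lsSol A y l) ∂μ = 0) :
    ENNReal.ofReal (errorBound m A y) ≤ predError μ S f A y := by
  -- An infinite error needs no argument. A finite one puts both estimators in `L²`, since `A` has a
  -- left inverse, and so supplies the integrability that `h` asks for.
  by_cases htop : predError μ S f A y = ⊤
  · rw [htop]; exact le_top
  rw [← predError_classicalSketch hS hm hA y]
  have htop' : predError μ S (classicalSketch m d) A y ≠ ⊤ := by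
    rw [predError_classicalSketch hS hm hA y]; exact ENNReal.ofReal_ne_top
  have hmeas : ∀ {g : Estimator m d}, Measurable g →
      Measurable fun ω => A *ᵥ (estimate S g A y ω - lsSol A y) := fun hg =>
    (continuous_const.matrix_mulVec continuous_id).measurable.comp
      ((hS.measurable_estimate hg A y).sub_const _)
  obtain ⟨hIf, hLf⟩ := integrable_sqNorm_of_lintegral (hmeas hf) htop
  obtain ⟨hIc, hLc⟩ := integrable_sqNorm_of_lintegral (hmeas measurable_classicalSketch) htop'
  have hLf' := memLp_of_memLp_mulVec hA hLf
  have hLc' := memLp_of_memLp_mulVec hA hLc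
  have hLd : ∀ j, MemLp (fun ω => estimate S f A y ω j -
      estimate S (classicalSketch m d) A y ω j) 2 μ := fun j => by
    refine ((hLf' j).sub (hLc' j)).ae_eq (ae_of_all _ fun ω => ?_)
    simp
  have hprod : ∀ j l, Integrable (fun ω => (estimate S f A y ω j -
        estimate S (classicalSketch m d) A y ω j) *
        (estimate S (classicalSketch m d) A y ω l - lsSol A y l)) μ := fun j l =>
    (hLd j).integrable_mul (hLc' l)
  rw [predError, predError, ← ofReal_integral_eq_lintegral_ofReal hIc
    (ae_of_all _ fun _ => sqNorm_nonneg _), ← ofReal_integral_eq_lintegral_ofReal hIf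
    (ae_of_all _ fun _ => sqNorm_nonneg _)]
  refine ENNReal.ofReal_le_ofReal ?_
  obtain ⟨hIs, hzero⟩ := integral_sum_mul_eq_zero (Aᵀ * A) hprod fun j l => h j l (hprod j l)
  calc ∫ ω, sqNorm (A *ᵥ (estimate S (classicalSketch m d) A y ω - lsSol A y)) ∂μ
      = ∫ ω, (2 * ∑ j, ∑ l, (Aᵀ * A) j l * ((estimate S f A y ω j -
          estimate S (classicalSketch m d) A y ω j) *
          (estimate S (classicalSketch m d) A y ω l - lsSol A y l)) +
          sqNorm (A *ᵥ (estimate S (classicalSketch m d) A y ω - lsSol A y))) ∂μ := by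
        rw [integral_add (hIs.const_mul 2) hIc, integral_const_mul, hzero, mul_zero, zero_add]
    _ ≤ ∫ ω, sqNorm (A *ᵥ (estimate S f A y ω - lsSol A y)) ∂μ := by
        refine integral_mono ((hIs.const_mul 2).add hIc) hIf fun ω => ?_
        have := sqNorm_mulVec_add A
          (estimate S f A y ω - estimate S (classicalSketch m d) A y ω)
          (estimate S (classicalSketch m d) A y ω - lsSol A y)
        simpa only [sub_add_sub_cancel, Pi.sub_apply] using this

lemma errorBound_eq_zero_of_sqNorm_eq_zero {y : Fin n → ℝ} (h : sqNorm (residual A y) = 0) :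
    errorBound m A y = 0 := by
  rw [errorBound, h, mul_zero]

end LowerBound

/-! ### The lower bound under conditional unbiasedness. -/

section ConditionallyUnbiased

variable {m n d : ℕ} {Ω : Type*} [MeasurableSpace Ω] {μ : Measure Ω} [IsProbabilityMeasure μ]
  {S : Ω → Matrix (Fin m) (Fin n) ℝ} {A : Matrix (Fin n) (Fin d) ℝ}

lemma measurable_toEntries : Measurable fun X : Matrix (Fin m) (Fin d) ℝ => toEntries X := by
  refine measurable_pi_iff.2 fun p => ?_
  exact (continuous_id.matrix_elem p.1 p.2).measurable

lemma IsCondUnbiased.model {y : Fin n → ℝ} {f : Estimator m d} (hf : IsCondUnbiased μ S A y f)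
    (hS : IsGaussianSketch μ S) {R : Matrix (Fin d) (Fin d) ℝ} {c : ℝ}
    (hM : IsModel m A (residual A y) R c) (x : Fin d → ℝ) :
    Integrable (fun p => f ((sketchModel R c p).1,
        (sketchModel R c p).1 *ᵥ x + (sketchModel R c p).2)) (noiseLaw m d) ∧
      ∀ B, MeasurableSet B → ∫ p in Prod.fst ⁻¹' B, (f ((sketchModel R c p).1,
        (sketchModel R c p).1 *ᵥ x + (sketchModel R c p).2) - x) ∂noiseLaw m d = 0 := by
  have e : estimate S f A (A *ᵥ x + residual A y) = fun ω =>
      f (S ω * A, (S ω * A) *ᵥ x + S ω *ᵥ residual A y) := funext fun ω => estimate_add f A x _ ω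
  obtain ⟨h1, h2⟩ := hf.2 x
  have hF := measurable_shift_comp hf.1 x
  rw [condExp_comap_ae_eq_const_iff (hS.measurable_mul A) h1] at h2
  rw [e] at h1 h2
  refine ⟨(hM.integrable_comp_iff hS hF).1 h1, fun B hB => ?_⟩
  -- As `R` is invertible, conditioning on `G R` is the same as conditioning on `G`; `B` is carried
  -- over by `R⁻¹`.
  have hB' : MeasurableSet {X : Matrix (Fin m) (Fin d) ℝ | toEntries (X * R⁻¹) ∈ B} := by
    simp_rw [toEntries_mul]
    exact ((measurable_rightMul _).comp measurable_toEntries) hB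
  have h3 := h2 _ hB'
  rw [hM.setIntegral_comp hS (hF.sub_const x) hB'] at h3
  convert h3 using 3
  ext p
  simp only [Set.mem_preimage, Set.mem_ofPred_eq, sketchModel]
  rw [Matrix.mul_assoc, Matrix.mul_nonsing_inv _ hM.isUnit, Matrix.mul_one]
  rfl

/-- The family indexed by `x` is a Gaussian shift family given `SA`, with the columns of `SA` as
directions. An unbiased estimator of zero is uncorrelated with its scores, and the least squares
error is a combination of these with coefficients depending on `SA`. -/
lemma IsCondUnbiased.errorBound_le_predError {y : Fin n → ℝ} {f : Estimator m d}
    (hf : IsCondUnbiased μ S A y f) (hS : IsGaussianSketch μ S) (hm : d + 1 < m)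
    (hA : A.rank = d) : ENNReal.ofReal (errorBound m A y) ≤ predError μ S f A y := by
  obtain ⟨R, c, hM⟩ := exists_isModel hm hA y
  rcases eq_or_ne c 0 with rfl | hc
  · have h0 : sqNorm (residual A y) = 0 := by
      have h1 := hM.sq
      have hm0 : (m : ℝ)⁻¹ ≠ 0 := inv_ne_zero (by exact_mod_cast (by omega : m ≠ 0))
      rw [zero_pow two_ne_zero, eq_comm, mul_eq_zero] at h1
      exact h1.resolve_left hm0
    rw [errorBound_eq_zero_of_sqNorm_eq_zero h0, ENNReal.ofReal_zero]
    exact zero_le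
  refine GaussianSketch.errorBound_le_predError hS hm hA y hf.1 fun j l hint => ?_
  set x₀ := lsSol A y with hx₀
  have hcl := isCondUnbiased_classicalSketch hS hm hA y
  have hest : ∀ (g : Estimator m d) (ω : Ω), estimate S g A y ω =
      g (S ω * A, (S ω * A) *ᵥ x₀ + S ω *ᵥ residual A y) := fun g ω => by
    have e : A *ᵥ x₀ + residual A y = y := mulVec_lsSol_add_residual A y
    rw [← estimate_add (S := S) g A x₀ (residual A y) ω, e]
  -- transfer to the model
  have hmf := measurable_shift_comp hf.1 x₀
  have hmc := measurable_shift_comp hcl.1 x₀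
  have hF : Measurable fun q : Matrix (Fin m) (Fin d) ℝ × (Fin m → ℝ) =>
      (f (q.1, q.1 *ᵥ x₀ + q.2) j - classicalSketch m d (q.1, q.1 *ᵥ x₀ + q.2) j) *
        (classicalSketch m d (q.1, q.1 *ᵥ x₀ + q.2) l - x₀ l) :=
    (((measurable_pi_apply j).comp hmf).sub ((measurable_pi_apply j).comp hmc)).mul
      (((measurable_pi_apply l).comp hmc).sub_const _)
  simp_rw [hest] at hint ⊢
  have htr := hM.setIntegral_comp hS hF MeasurableSet.univ
  simp only [Set.preimage_univ, Measure.restrict_univ] at htr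
  rw [htr]
  have hint' := (hM.integrable_comp_iff hS hF).1 hint
  set X : (Fin m × Fin d → ℝ) → Matrix (Fin m) (Fin d) ℝ := fun x => ofEntries x * R with hX
  have hXc : Continuous X := continuous_ofEntries.matrix_mul continuous_const
  have hXm : Measurable X := hXc.measurable
  set D : (Fin m × Fin d → ℝ) × (Fin m → ℝ) → ℝ := fun p =>
    f (X p.1, X p.1 *ᵥ x₀ + c • p.2) j - classicalSketch m d (X p.1, X p.1 *ᵥ x₀ + c • p.2) j
    with hD
  have hDm : Measurable D := by
    have h1 := (hmf.comp (measurable_sketchModel (m := m) R c))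
    have h2 := (hmc.comp (measurable_sketchModel (m := m) R c))
    exact ((measurable_pi_apply j).comp h1).sub ((measurable_pi_apply j).comp h2)
  -- the least squares error in the model
  have hols : ∀ᵐ p ∂noiseLaw m d, (f ((sketchModel R c p).1,
      (sketchModel R c p).1 *ᵥ x₀ + (sketchModel R c p).2) j -
      classicalSketch m d ((sketchModel R c p).1,
        (sketchModel R c p).1 *ᵥ x₀ + (sketchModel R c p).2) j) *
      (classicalSketch m d ((sketchModel R c p).1,
        (sketchModel R c p).1 *ᵥ x₀ + (sketchModel R c p).2) l - x₀ l) =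
      c * (D p * ols (X p.1) p.2 l) := by
    filter_upwards [ae_noiseLaw_isUnit hm] with p hp
    have hu := isUnit_det_gram_mul hp hM.isUnit
    have h1 : classicalSketch m d ((sketchModel R c p).1,
        (sketchModel R c p).1 *ᵥ x₀ + (sketchModel R c p).2) =
        x₀ + c • ols (X p.1) p.2 := by
      simp only [classicalSketch, sketchModel]
      rw [lsSol_eq_ols, ols_add, ols_mulVec hu, ols_smul]
    have h2 : D p = f ((sketchModel R c p).1,
      (sketchModel R c p).1 *ᵥ x₀ + (sketchModel R c p).2) j -
      classicalSketch m d ((sketchModel R c p).1,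
        (sketchModel R c p).1 *ᵥ x₀ + (sketchModel R c p).2) j := rfl
    rw [← h2, h1]
    simp only [Pi.add_apply, Pi.smul_apply, smul_eq_mul]
    ring
  rw [integral_congr_ae hols, integral_const_mul]
  have hI : Integrable (fun p => D p * ols (X p.1) p.2 l) (noiseLaw m d) := by
    refine ((hint'.congr hols).const_mul c⁻¹).congr (ae_of_all _ fun p => ?_)
    simp only
    rw [inv_mul_cancel_left₀ hc]
  refine mul_eq_zero_of_right c ?_
  -- truncation
  have hinvm : ∀ i, Measurable fun x => ((X x)ᵀ * X x)⁻¹ l i := fun i =>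
    measurable_inv_apply (hXc.matrix_transpose.matrix_mul hXc) l i
  have hum : ∀ i, Measurable fun x => (X x).col i := fun i =>
    measurable_pi_iff.2 fun k => (hXc.matrix_elem k i).measurable
  -- On `E N` the coefficients and the shift directions are bounded by `N`, as the score identity
  -- requires. The sets increase to the whole space, so integrability of the full product allows the
  -- limit.
  let E : ℕ → Set (Fin m × Fin d → ℝ) := fun N =>
    {x | ∀ i, |((X x)ᵀ * X x)⁻¹ l i| ≤ N ∧ ∑ k, (X x).col i k ^ 2 ≤ N}
  have hEm : ∀ N, MeasurableSet (E N) := by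
    intro N
    have : E N = ⋂ i, ({x | |((X x)ᵀ * X x)⁻¹ l i| ≤ N} ∩ {x | ∑ k, (X x).col i k ^ 2 ≤ N}) := by
      ext x; simp [E]
    rw [this]
    refine MeasurableSet.iInter fun i => MeasurableSet.inter ?_ ?_
    · exact measurableSet_le ((continuous_abs.measurable).comp (hinvm i)) measurable_const
    · refine measurableSet_le ?_ measurable_const
      exact Finset.measurable_sum _ fun k _ =>
        ((measurable_pi_apply k).comp (hum i)).pow_const 2
  have hmono : Monotone fun N => (Prod.fst ⁻¹' E N :
      Set ((Fin m × Fin d → ℝ) × (Fin m → ℝ))) := by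
    intro N N' hN p hp i
    have hN' : (N : ℝ) ≤ N' := by exact_mod_cast hN
    exact ⟨(hp i).1.trans hN', (hp i).2.trans hN'⟩
  have hunion : ⋃ N, (Prod.fst ⁻¹' E N :
      Set ((Fin m × Fin d → ℝ) × (Fin m → ℝ))) = Set.univ := by
    refine Set.eq_univ_of_forall fun p => Set.mem_iUnion.2 ?_
    obtain ⟨N, hN⟩ := exists_nat_ge (∑ i, (|((X p.1)ᵀ * X p.1)⁻¹ l i| +
      ∑ k, (X p.1).col i k ^ 2))
    refine ⟨N, fun i => ?_⟩
    have h1 : |((X p.1)ᵀ * X p.1)⁻¹ l i| + ∑ k, (X p.1).col i k ^ 2 ≤ N :=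
      (Finset.single_le_sum (f := fun i => |((X p.1)ᵀ * X p.1)⁻¹ l i| +
        ∑ k, (X p.1).col i k ^ 2) (fun i _ => by positivity) (Finset.mem_univ i)).trans hN
    have h2 : 0 ≤ ∑ k, (X p.1).col i k ^ 2 := by positivity
    have h3 := abs_nonneg (((X p.1)ᵀ * X p.1)⁻¹ l i)
    exact ⟨by linarith, by linarith⟩
  have hlim := tendsto_setIntegral_of_monotone (μ := noiseLaw m d)
    (f := fun p => D p * ols (X p.1) p.2 l) (fun N => measurable_fst (hEm N)) hmono
    hI.integrableOn
  rw [hunion, Measure.restrict_univ] at hlim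
  refine tendsto_nhds_unique hlim (tendsto_const_nhds.congr fun N => ?_)
  symm
  rw [← integral_indicator (measurable_fst (hEm N))]
  -- This is row `l` of `(XᵀX)⁻¹ Xᵀ g`, written as a combination of the scores `⟨X.col i, g⟩`.
  have hexp : ∀ p, (Prod.fst ⁻¹' E N).indicator (fun p => D p * ols (X p.1) p.2 l) p =
      ∑ i, D p * (E N).indicator (fun x => ((X x)ᵀ * X x)⁻¹ l i) p.1 *
        ((X p.1).col i ⬝ᵥ p.2) := by
    intro p
    by_cases hp : p.1 ∈ E N
    · rw [Set.indicator_of_mem (by exact hp)]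
      simp only [Set.indicator_of_mem hp, mul_assoc, ← Finset.mul_sum]
      rfl
    · rw [Set.indicator_of_notMem (by exact hp)]
      simp [Set.indicator_of_notMem hp]
  simp_rw [hexp]
  -- the score identity
  have hscore : ∀ i, Integrable (fun p => D p *
        (E N).indicator (fun x => ((X x)ᵀ * X x)⁻¹ l i) p.1 * ((X p.1).col i ⬝ᵥ p.2))
        (noiseLaw m d) ∧
      ∫ p, D p * (E N).indicator (fun x => ((X x)ᵀ * X x)⁻¹ l i) p.1 *
        ((X p.1).col i ⬝ᵥ p.2) ∂noiseLaw m d = 0 := by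
    intro i
    -- Shifting the noise by `t` times column `i` amounts to moving the unknown `x₀` by `c t` in
    -- coordinate `i`, where unbiasedness holds as well.
    have hshift : ∀ (t : ℝ) (p : (Fin m × Fin d → ℝ) × (Fin m → ℝ)),
        (X p.1, X p.1 *ᵥ x₀ + c • (p.2 + t • (X p.1).col i)) =
        ((sketchModel R c p).1, (sketchModel R c p).1 *ᵥ (x₀ + (c * t) • Pi.single i 1) +
          (sketchModel R c p).2) := by
      intro t p
      refine Prod.ext rfl ?_
      change X p.1 *ᵥ x₀ + c • (p.2 + t • (X p.1).col i) =
          X p.1 *ᵥ (x₀ + (c * t) • Pi.single i 1) + c • p.2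
      rw [Matrix.mulVec_add, Matrix.mulVec_smul, Matrix.mulVec_single_one, smul_add, smul_smul]
      abel
    refine integral_mul_score_eq_zero (hum i) hDm (fun t => ?_) (fun t B hB => ?_)
      ((hinvm i).indicator (hEm N)) (C := N) (fun x => ?_) (fun x hx => ?_)
    · simp only [hD, hshift]
      exact ((hf.model hS hM _).1.eval j).sub ((hcl.model hS hM _).1.eval j)
    · simp only [hD, hshift]
      obtain ⟨h1, h2⟩ := hf.model hS hM (x₀ + (c * t) • Pi.single i 1)
      obtain ⟨h3, h4⟩ := hcl.model hS hM (x₀ + (c * t) • Pi.single i 1)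
      have h5 := h2 B hB
      have h6 := h4 B hB
      rw [integral_sub h1.integrableOn (integrable_const _).integrableOn, sub_eq_zero] at h5
      rw [integral_sub h3.integrableOn (integrable_const _).integrableOn, sub_eq_zero] at h6
      have h7 := congrFun (h5.trans h6.symm) j
      rw [eval_integral fun k => h1.integrableOn.eval k,
        eval_integral fun k => h3.integrableOn.eval k] at h7
      exact (integral_sub (h1.eval j).integrableOn (h3.eval j).integrableOn).trans
        (sub_eq_zero.2 h7)
    · by_cases hx : x ∈ E N
      · rw [Set.indicator_of_mem hx]; exact (hx i).1
      · rw [Set.indicator_of_notMem hx, abs_zero]; positivity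
    · have hx' : x ∈ E N := by
        by_contra hne
        exact hx (Set.indicator_of_notMem hne _)
      exact (hx' i).2
  rw [integral_finsetSum _ fun i _ => (hscore i).1]
  exact Finset.sum_eq_zero fun i _ => (hscore i).2

end ConditionallyUnbiased

/-! ### Completeness of the Gram matrix. -/

section GramSufficiency

variable {m : ℕ} {κ : Type*} [Fintype κ] [DecidableEq κ]

/-- The sum `C` of the absolute entries bounds the quadratic form of `H`. Taking `(C + 1)⁻¹` keeps
the radius defined for `H = 0` and the inequality strict. -/
lemma exists_posDef_one_sub_smul {H : Matrix κ κ ℝ} (hH : H.IsSymm) :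
    ∃ ε > 0, ∀ t : ℝ, |t| < ε → (1 - t • H).PosDef := by
  set C : ℝ := ∑ k, ∑ l, |H k l| with hC
  have hC0 : 0 ≤ C := by positivity
  refine ⟨(C + 1)⁻¹, by positivity, fun t ht => ?_⟩
  refine Matrix.PosDef.of_dotProduct_mulVec_pos ?_ fun x hx => ?_
  · rw [Matrix.IsHermitian, Matrix.conjTranspose_eq_transpose_of_trivial, Matrix.transpose_sub,
      Matrix.transpose_one, Matrix.transpose_smul, hH]
  · rw [star_trivial, Matrix.sub_mulVec, Matrix.one_mulVec, dotProduct_sub, Matrix.smul_mulVec,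
      dotProduct_smul, smul_eq_mul]
    have hpos : 0 < x ⬝ᵥ x := by
      have h0 : 0 ≤ x ⬝ᵥ x := Finset.sum_nonneg fun i _ => mul_self_nonneg _
      exact lt_of_le_of_ne h0 fun h => hx (dotProduct_self_eq_zero.1 h.symm)
    have hle : ∀ k, |x k| ^ 2 ≤ x ⬝ᵥ x := fun k => by
      rw [sq_abs, sq]
      exact Finset.single_le_sum (f := fun k => x k * x k) (fun i _ => mul_self_nonneg _)
        (Finset.mem_univ k)
    have hb : |x ⬝ᵥ H *ᵥ x| ≤ C * (x ⬝ᵥ x) := by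
      have he : x ⬝ᵥ H *ᵥ x = ∑ k, ∑ l, H k l * (x k * x l) := by
        simp only [dotProduct, Matrix.mulVec, Finset.mul_sum]
        exact Finset.sum_congr rfl fun k _ => Finset.sum_congr rfl fun l _ => by ring
      rw [he]
      refine (Finset.abs_sum_le_sum_abs _ _).trans ?_
      rw [hC, Finset.sum_mul]
      refine Finset.sum_le_sum fun k _ => (Finset.abs_sum_le_sum_abs _ _).trans ?_
      rw [Finset.sum_mul]
      refine Finset.sum_le_sum fun l _ => ?_
      rw [abs_mul, abs_mul]
      refine mul_le_mul_of_nonneg_left ?_ (abs_nonneg _)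
      nlinarith [sq_nonneg (|x k| - |x l|), hle k, hle l]
    have h1 : |t * (x ⬝ᵥ H *ᵥ x)| ≤ (C + 1)⁻¹ * (C * (x ⬝ᵥ x)) := by
      rw [abs_mul]
      exact mul_le_mul ht.le hb (abs_nonneg _) (by positivity)
    have h2 : (C + 1)⁻¹ * (C * (x ⬝ᵥ x)) < x ⬝ᵥ x := by
      rw [inv_mul_lt_iff₀ (by positivity)]
      nlinarith
    linarith [le_abs_self (t * (x ⬝ᵥ H *ᵥ x))]

/-- The entries of the Gram matrix. -/
def gramEntries (x : Fin m × κ → ℝ) : κ × κ → ℝ := fun p => ∑ i, x (i, p.1) * x (i, p.2)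

lemma gramEntries_eq (x : Fin m × κ → ℝ) (k l : κ) :
    gramEntries x (k, l) = ((ofEntries x : Matrix (Fin m) κ ℝ)ᵀ * ofEntries x) k l := by
  rw [Matrix.mul_apply]; rfl

lemma measurable_gramEntries : Measurable (gramEntries : (Fin m × κ → ℝ) → _) := by
  unfold gramEntries; fun_prop

lemma sum_sq_rightMul (C : Matrix κ κ ℝ) (x : Fin m × κ → ℝ) :
    ∑ p, rightMul m C x p ^ 2 = ∑ p : κ × κ, (C * Cᵀ) p.1 p.2 * gramEntries x p := by
  have h1 : ∀ i, ∑ j, rightMul m C x (i, j) ^ 2 =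
      ∑ k, ∑ l, (C * Cᵀ) k l * (x (i, k) * x (i, l)) := by
    intro i
    have h2 : ∀ j, rightMul m C x (i, j) ^ 2 =
        ∑ k, ∑ l, x (i, k) * C k j * (x (i, l) * C l j) := fun j => by
      rw [sq, rightMul_apply, Finset.sum_mul_sum]
    rw [Finset.sum_congr rfl fun j _ => h2 j, Finset.sum_comm]
    refine Finset.sum_congr rfl fun k _ => ?_
    rw [Finset.sum_comm]
    refine Finset.sum_congr rfl fun l _ => ?_
    rw [Matrix.mul_apply, Finset.sum_mul]
    exact Finset.sum_congr rfl fun j _ => by rw [Matrix.transpose_apply]; ring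
  rw [Fintype.sum_prod_type, Finset.sum_congr rfl fun i _ => h1 i, Finset.sum_comm,
    Fintype.sum_prod_type]
  refine Finset.sum_congr rfl fun k _ => ?_
  rw [Finset.sum_comm]
  refine Finset.sum_congr rfl fun l _ => ?_
  rw [gramEntries, Finset.mul_sum]

lemma sum_sq_eq_sum_gramEntries (x : Fin m × κ → ℝ) :
    ∑ p, x p ^ 2 = ∑ p : κ × κ, (1 : Matrix κ κ ℝ) p.1 p.2 * gramEntries x p := by
  have h := sum_sq_rightMul (1 : Matrix κ κ ℝ) x
  rwa [rightMul_one, Matrix.transpose_one, Matrix.mul_one] at h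

/-- Right multiplication by an invertible matrix, as a linear equivalence. -/
noncomputable def rightMulEquiv (m : ℕ) (T : Matrix κ κ ℝ) (hT : IsUnit T.det) :
    (Fin m × κ → ℝ) ≃ₗ[ℝ] (Fin m × κ → ℝ) :=
  LinearEquiv.ofLinearMap (rightMul m T) (rightMul m T⁻¹)
    (LinearMap.ext fun x => by
      rw [LinearMap.comp_apply, ← rightMul_mul, Matrix.nonsing_inv_mul _ hT, rightMul_one]; rfl)
    (LinearMap.ext fun x => by
      rw [LinearMap.comp_apply, ← rightMul_mul, Matrix.mul_nonsing_inv _ hT, rightMul_one]; rfl)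

/-- If all the integrals of `D` against centered Gaussian matrices with independent rows vanish,
then so do the tilted integrals of `D` near the standard Gaussian law. -/
lemma integral_mul_exp_gramEntries_eq_zero {D : (Fin m × κ → ℝ) → ℝ} (hD : Measurable D)
    (h : ∀ T : Matrix κ κ ℝ, IsUnit T.det →
      Integrable (fun x => D (rightMul m T x)) (stdNormal (Fin m × κ)) ∧
      ∫ x, D (rightMul m T x) ∂stdNormal (Fin m × κ) = 0)
    {K : Matrix κ κ ℝ} (hK : K.PosDef) :
    Integrable (fun x => D x * Real.exp ((∑ p, (1 - K) p.1 p.2 * gramEntries x p) / 2))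
      (stdNormal (Fin m × κ)) ∧
      ∫ x, D x * Real.exp ((∑ p, (1 - K) p.1 p.2 * gramEntries x p) / 2)
        ∂stdNormal (Fin m × κ) = 0 := by
  obtain ⟨R, hR, hRK⟩ := exists_transpose_mul_self_of_posDef hK
  have hRt : IsUnit Rᵀ.det := by rwa [Matrix.det_transpose]
  have hTi : (Rᵀ)⁻¹⁻¹ = Rᵀ := Matrix.nonsing_inv_nonsing_inv _ hRt
  have hT : IsUnit ((Rᵀ)⁻¹).det := Matrix.isUnit_nonsing_inv_det _ hRt
  obtain ⟨h1, h2⟩ := h _ hT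
  -- `K` is the precision matrix: the inverse map is right multiplication by `Rᵀ`, and `‖x Rᵀ‖²`
  -- pairs `RᵀR = K` with the Gram matrix of `x`. The Jacobian is a nonzero finite constant and
  -- drops out.
  set L := rightMulEquiv m (Rᵀ)⁻¹ hT with hL
  let φ : (Fin m × κ → ℝ) ≃ᵐ (Fin m × κ → ℝ) :=
    L.toContinuousLinearEquiv.toHomeomorph.toMeasurableEquiv
  have hdet : LinearMap.det (L : (Fin m × κ → ℝ) →ₗ[ℝ] _) ≠ 0 := (LinearEquiv.isUnit_det' L).ne_zero
  have hvol := Measure.map_linearMap_addHaar_eq_smul_addHaar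
    (volume : Measure (Fin m × κ → ℝ)) hdet
  set a := ENNReal.ofReal |(LinearMap.det (L : (Fin m × κ → ℝ) →ₗ[ℝ] _))⁻¹| with ha
  have ha0 : a ≠ 0 := by
    rw [ha, Ne, ENNReal.ofReal_eq_zero, not_le]
    exact abs_pos.2 (inv_ne_zero hdet)
  have hat : a ≠ ⊤ := ENNReal.ofReal_ne_top
  have hmap := stdNormal_map_equiv φ a hvol
  have hφ : ∀ x, φ x = rightMul m (Rᵀ)⁻¹ x := fun _ => rfl
  have hφs : ∀ x, φ.symm x = rightMul m Rᵀ x := fun x => by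
    have : φ.symm x = rightMul m (Rᵀ)⁻¹⁻¹ x := rfl
    rw [this, hTi]
  have hexp : ∀ x, Real.exp ((∑ p, x p ^ 2) / 2 - (∑ p, φ.symm x p ^ 2) / 2) =
      Real.exp ((∑ p, (1 - K) p.1 p.2 * gramEntries x p) / 2) := by
    intro x
    rw [hφs, sum_sq_rightMul, Matrix.transpose_transpose, hRK, sum_sq_eq_sum_gramEntries,
      ← sub_div, ← Finset.sum_sub_distrib]
    simp only [Matrix.sub_apply, sub_mul]
  have hw : Measurable fun x : Fin m × κ → ℝ =>
      Real.exp ((∑ p, (1 - K) p.1 p.2 * gramEntries x p) / 2) := by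
    have := measurable_gramEntries (m := m) (κ := κ)
    fun_prop
  simp_rw [hexp] at hmap
  simp_rw [← hφ] at h1 h2
  have e : ∀ x, (ENNReal.ofReal (Real.exp
      ((∑ p, (1 - K) p.1 p.2 * gramEntries x p) / 2))).toReal • D x =
      D x * Real.exp ((∑ p, (1 - K) p.1 p.2 * gramEntries x p) / 2) := fun x => by
    rw [ENNReal.toReal_ofReal (Real.exp_pos _).le, smul_eq_mul, mul_comm]
  constructor
  · have h3 := (integrable_map_measure (f := φ) (g := D) hD.aestronglyMeasurable
      φ.measurable.aemeasurable).2 h1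
    rw [hmap, integrable_smul_measure ha0 hat, integrable_withDensity_iff_integrable_smul'
      hw.ennreal_ofReal (ae_of_all _ fun _ => ENNReal.ofReal_lt_top)] at h3
    exact h3.congr (ae_of_all _ e)
  · have h3 := integral_map (φ := φ) (f := D) (μ := stdNormal (Fin m × κ))
      φ.measurable.aemeasurable hD.aestronglyMeasurable
    rw [h2, hmap, integral_smul_measure, integral_withDensity_eq_integral_toReal_smul
      hw.ennreal_ofReal (ae_of_all _ fun _ => ENNReal.ofReal_lt_top),
      integral_congr_ae (ae_of_all _ e), smul_eq_zero] at h3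
    exact h3.resolve_left (ENNReal.toReal_ne_zero.2 ⟨ha0, hat⟩)

/-- Completeness of the Gram matrix in the family of centered Gaussian matrices with independent
identically distributed rows. -/
lemma sameSignedLaw_gramEntries {D : (Fin m × κ → ℝ) → ℝ} (hD : Measurable D)
    (h : ∀ T : Matrix κ κ ℝ, IsUnit T.det →
      Integrable (fun x => D (rightMul m T x)) (stdNormal (Fin m × κ)) ∧
      ∫ x, D (rightMul m T x) ∂stdNormal (Fin m × κ) = 0) :
    SameSignedLaw (stdNormal (Fin m × κ)) D gramEntries := by
  have hDi : Integrable D (stdNormal (Fin m × κ)) := by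
    have h1 := (h 1 (by simp)).1
    simpa only [rightMul_one] using h1
  have := isFiniteMeasure_withDensity_ofReal_of_integrable hDi
  have := isFiniteMeasure_withDensity_ofReal_of_integrable hDi.neg
  -- As in Cramér–Wold, it suffices to treat one linear functional `ℓ` of the Gram matrix at a time.
  refine Measure.ext_of_charFunDual (funext fun ℓ => ?_)
  have hlin : ∀ w : κ × κ → ℝ, ℓ w = ∑ p, ℓ (Pi.single p 1) * w p := fun w => by
    conv_lhs => rw [← Finset.univ_sum_single w]
    rw [map_sum]
    refine Finset.sum_congr rfl fun p _ => ?_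
    have : Pi.single p (w p) = w p • Pi.single p (1 : ℝ) := by
      rw [← Pi.single_smul, smul_eq_mul, mul_one]
    rw [this, map_smul, smul_eq_mul, mul_comm]
  -- A Gram matrix is symmetric and sees only the symmetric part of `ℓ`. The sum is not halved,
  -- which absorbs the `1/2` in the Gaussian exponent.
  let H : Matrix κ κ ℝ := Matrix.of fun k l => ℓ (Pi.single (k, l) 1) + ℓ (Pi.single (l, k) 1)
  have hH : H.IsSymm := by
    ext k l
    simp only [H, Matrix.transpose_apply, Matrix.of_apply]
    ring
  have hHw : ∀ x : Fin m × κ → ℝ, (∑ p, H p.1 p.2 * gramEntries x p) / 2 =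
      ℓ (gramEntries x) := fun x => by
    have h1 : ∑ p : κ × κ, ℓ (Pi.single (p.2, p.1) 1) * gramEntries x p =
        ∑ p : κ × κ, ℓ (Pi.single p 1) * gramEntries x p := by
      rw [← Equiv.sum_comp (Equiv.prodComm κ κ)]
      refine Finset.sum_congr rfl fun p _ => ?_
      congr 1
      simp only [gramEntries, Equiv.prodComm_apply, Prod.fst_swap, Prod.snd_swap]
      exact Finset.sum_congr rfl fun i _ => mul_comm _ _
    have h2 : ∑ p : κ × κ, H p.1 p.2 * gramEntries x p = ℓ (gramEntries x) + ℓ (gramEntries x) := by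
      simp only [H, Matrix.of_apply, add_mul, Finset.sum_add_distrib]
      rw [h1, hlin]
    rw [h2]; ring
  obtain ⟨ε, hε, hpos⟩ := exists_posDef_one_sub_smul hH
  have hℓm : Measurable ℓ := ℓ.continuous.measurable
  have hs : SameSignedLaw (stdNormal (Fin m × κ)) D fun x => ℓ (gramEntries x) := by
    refine sameSignedLaw_of_exp hD (hℓm.comp measurable_gramEntries) hε fun t ht => ?_
    have h1 := integral_mul_exp_gramEntries_eq_zero hD h (hpos t ht)
    have e : ∀ x : Fin m × κ → ℝ,
        (∑ p, (1 - (1 - t • H)) p.1 p.2 * gramEntries x p) / 2 = t * ℓ (gramEntries x) := by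
      intro x
      rw [← hHw, sub_sub_cancel, mul_div_assoc', Finset.mul_sum]
      simp only [Matrix.smul_apply, smul_eq_mul, mul_assoc]
    simp_rw [e] at h1
    exact h1
  rw [charFunDual_eq_charFun_map_one, charFunDual_eq_charFun_map_one,
    Measure.map_map hℓm measurable_gramEntries, Measure.map_map hℓm measurable_gramEntries]
  exact congrArg (fun ν => charFun ν 1) hs

end GramSufficiency

/-! ### The lower bound under unbiasedness for all data. -/

section Unbiased

variable {m n d : ℕ} {Ω : Type*} [MeasurableSpace Ω] {μ : Measure Ω} [IsProbabilityMeasure μ]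
  {S : Ω → Matrix (Fin m) (Fin n) ℝ}

/-- The data of a least squares problem, from the entries of the augmented matrix. -/
def splitData (x : Fin m × (Fin d ⊕ Unit) → ℝ) : Matrix (Fin m) (Fin d) ℝ × (Fin m → ℝ) :=
  (ofEntries (splitLast x).1, (splitLast x).2)

lemma measurable_splitData :
    Measurable (splitData : (Fin m × (Fin d ⊕ Unit) → ℝ) → _) :=
  (measurable_ofEntries.comp (measurable_fst.comp measurable_splitLast)).prodMk
    (measurable_snd.comp measurable_splitLast)

lemma estimate_eq_splitData (f : Estimator m d) (M : Matrix (Fin n) (Fin d ⊕ Unit) ℝ) (ω : Ω) :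
    estimate S f M.toCols₁ (fun i => M i (.inr ())) ω = f (splitData (toEntries (S ω * M))) := by
  rw [estimate, splitData]
  congr 1

lemma IsGaussianSketch.measurable_toEntries_mul {κ : Type*} [Fintype κ]
    (hS : IsGaussianSketch μ S) (M : Matrix (Fin n) κ ℝ) :
    Measurable fun ω => GaussianSketch.toEntries (S ω * M) := by
  simp_rw [toEntries_mul]
  exact (measurable_rightMul M).comp hS.measurable_toEntries

lemma rank_toCols₁ {M : Matrix (Fin n) (Fin d ⊕ Unit) ℝ} (hM : Function.Injective M.mulVec) :
    M.toCols₁.rank = d := by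
  rw [← isUnit_det_gram_iff_rank, isUnit_det_gram_iff]
  intro u v huv
  have h : M *ᵥ Sum.elim u 0 = M *ᵥ Sum.elim v 0 := by
    rw [← Matrix.fromCols_toCols M, Matrix.fromCols_mulVec, Matrix.fromCols_mulVec]
    simp only [Sum.elim_comp_inl, Sum.elim_comp_inr, Matrix.mulVec_zero, add_zero]
    exact huv
  funext i
  exact congrFun (hM h) (.inl i)

lemma IsUnbiased.integral_splitData {f : Estimator m d} (hf : IsUnbiased μ S f)
    (hS : IsGaussianSketch μ S) {M : Matrix (Fin n) (Fin d ⊕ Unit) ℝ}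
    (hM : Function.Injective M.mulVec) {T : Matrix (Fin d ⊕ Unit) (Fin d ⊕ Unit) ℝ}
    (hT : Tᵀ * T = (m : ℝ)⁻¹ • (Mᵀ * M)) :
    Integrable (fun x => f (splitData (rightMul m T x))) (stdNormal (Fin m × (Fin d ⊕ Unit))) ∧
      ∫ x, f (splitData (rightMul m T x)) ∂stdNormal (Fin m × (Fin d ⊕ Unit)) =
        lsSol M.toCols₁ (fun i => M i (.inr ())) := by
  obtain ⟨h1, h2⟩ := hf.2 _ (rank_toCols₁ hM) (fun i => M i (.inr ()))
  have hlaw := hS.map_toEntries_mul M T hT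
  have hF : Measurable fun x : Fin m × (Fin d ⊕ Unit) → ℝ => f (splitData x) :=
    hf.1.comp measurable_splitData
  have hmS := hS.measurable_toEntries_mul M
  have e : estimate S f M.toCols₁ (fun i => M i (.inr ())) =
      fun ω => f (splitData (toEntries (S ω * M))) := funext fun ω => estimate_eq_splitData f M ω
  rw [e] at h1 h2
  constructor
  · have h3 := (integrable_map_measure (g := fun x => f (splitData x)) hF.aestronglyMeasurable
      hmS.aemeasurable).2 h1
    rw [hlaw] at h3
    exact (integrable_map_measure hF.aestronglyMeasurable
      (measurable_rightMul T).aemeasurable).1 h3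
  · have h3 := integral_map (μ := μ) (f := fun x => f (splitData x)) hmS.aemeasurable
      hF.aestronglyMeasurable
    rw [h2, hlaw, integral_map (measurable_rightMul T).aemeasurable
      hF.aestronglyMeasurable] at h3
    exact h3

/-- A relation involving `y` would put `y` in the range of `A` and make the residual zero.
Injectivity makes the covariance of the augmented sketch invertible. -/
lemma injective_fromCols_mulVec {A : Matrix (Fin n) (Fin d) ℝ} (hA : A.rank = d) {y : Fin n → ℝ}
    (hy : residual A y ≠ 0) :
    Function.Injective (Matrix.fromCols A (Matrix.replicateCol Unit y)).mulVec := by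
  have hu := isUnit_det_gram_iff_rank.2 hA
  rw [← Matrix.coe_mulVecLin, injective_iff_map_eq_zero]
  intro v hv
  rw [Matrix.coe_mulVecLin, Matrix.fromCols_mulVec] at hv
  have h1 : Matrix.replicateCol Unit y *ᵥ (v ∘ Sum.inr) = v (.inr ()) • y := by
    ext i
    simp [Matrix.mulVec, dotProduct, mul_comm]
  rw [h1] at hv
  have hc : v (.inr ()) = 0 := by
    by_contra hc
    refine hy ?_
    have hy' : y = A *ᵥ (-(v (.inr ()))⁻¹ • (v ∘ Sum.inl)) := by
      rw [Matrix.mulVec_smul, eq_neg_of_add_eq_zero_left hv, smul_neg, neg_smul, neg_neg,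
        smul_smul, inv_mul_cancel₀ hc, one_smul]
    rw [residual, lsSol_eq_ols]
    nth_rw 2 [hy']
    rw [ols_mulVec hu, ← hy', sub_self]
  rw [hc, zero_smul, add_zero] at hv
  have h0 : v ∘ Sum.inl = 0 := (isUnit_det_gram_iff A).1 hu (by rw [hv, Matrix.mulVec_zero])
  funext k
  rcases k with k | k
  · exact congrFun h0 k
  · exact hc

/-- The least squares solution depends only on the Gram matrix of the augmented matrix. -/
lemma exists_ols_splitData_eq (T : Matrix (Fin d ⊕ Unit) (Fin d ⊕ Unit) ℝ) (l : Fin d) :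
    ∃ h : ((Fin d ⊕ Unit) × (Fin d ⊕ Unit) → ℝ) → ℝ, Measurable h ∧
      ∀ x : Fin m × (Fin d ⊕ Unit) → ℝ,
        classicalSketch m d (splitData (rightMul m T x)) l = h (gramEntries x) := by
  let N : ((Fin d ⊕ Unit) × (Fin d ⊕ Unit) → ℝ) → Matrix (Fin d ⊕ Unit) (Fin d ⊕ Unit) ℝ :=
    fun w => Tᵀ * Matrix.of (fun k l => w (k, l)) * T
  have hN : Continuous N := by
    refine (continuous_const.matrix_mul ?_).matrix_mul continuous_const
    exact continuous_matrix fun k l => continuous_apply (k, l)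
  have hN11 : Continuous fun w => (N w).toBlocks₁₁ :=
    continuous_matrix fun k l => hN.matrix_elem (.inl k) (.inl l)
  have hgram : ∀ x : Fin m × (Fin d ⊕ Unit) → ℝ, N (gramEntries x) =
      (ofEntries (rightMul m T x) : Matrix (Fin m) _ ℝ)ᵀ * ofEntries (rightMul m T x) := fun x => by
    have e : Matrix.of (fun k l => gramEntries x (k, l)) =
        (ofEntries x : Matrix (Fin m) _ ℝ)ᵀ * ofEntries x :=
      Matrix.ext fun k l => gramEntries_eq x k l
    simp only [N]
    rw [e, ofEntries_rightMul, Matrix.transpose_mul]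
    simp only [Matrix.mul_assoc]
  -- In the Gram matrix of `(X | z)` the upper left block is `XᵀX` and the upper right one is `Xᵀz`.
  refine ⟨fun w => ∑ j, ((N w).toBlocks₁₁)⁻¹ l j * N w (.inl j) (.inr ()), ?_, fun x => ?_⟩
  · refine Finset.measurable_sum _ fun j _ => ?_
    exact (measurable_inv_apply hN11 l j).mul (hN.matrix_elem (.inl j) (.inr ())).measurable
  · simp only [hgram]
    rw [classicalSketch, lsSol_eq_ols]
    rfl

/-- The difference `D` has mean zero under every invertible covariance, hence zero conditional mean
given the complete Gram matrix, of which the least squares solution is a function. -/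
lemma IsUnbiased.errorBound_le_predError {f : Estimator m d} (hf : IsUnbiased μ S f)
    (hS : IsGaussianSketch μ S) (hm : d + 1 < m) {A : Matrix (Fin n) (Fin d) ℝ}
    (hA : A.rank = d) (y : Fin n → ℝ) :
    ENNReal.ofReal (errorBound m A y) ≤ predError μ S f A y := by
  by_cases hy : residual A y = 0
  · rw [errorBound_eq_zero_of_sqNorm_eq_zero (sqNorm_eq_zero.2 hy), ENNReal.ofReal_zero]
    exact zero_le
  refine GaussianSketch.errorBound_le_predError hS hm hA y hf.1 fun j l hint => ?_
  have hcl := isUnbiased_classicalSketch hS hm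
  set M := Matrix.fromCols A (Matrix.replicateCol Unit y) with hMdef
  have hM : Function.Injective M.mulVec := injective_fromCols_mulVec hA hy
  have hm0 : (m : ℝ) ≠ 0 := by exact_mod_cast (by omega : m ≠ 0)
  obtain ⟨T₀, hT₀, hT₀M⟩ := exists_transpose_mul_self_of_posDef
    (posDef_smul_transpose_mul_self hM (a := (m : ℝ)⁻¹) (by positivity))
  have hlaw := hS.map_toEntries_mul M T₀ hT₀M
  have hest : ∀ (g : Estimator m d) (ω : Ω), estimate S g A y ω =
      g (splitData (toEntries (S ω * M))) := fun g ω => estimate_eq_splitData g M ω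
  obtain ⟨h, hh, hols⟩ := exists_ols_splitData_eq (m := m) T₀ l
  set D : (Fin m × (Fin d ⊕ Unit) → ℝ) → ℝ := fun x =>
    f (splitData (rightMul m T₀ x)) j - classicalSketch m d (splitData (rightMul m T₀ x)) j
  have hsplit : Measurable fun x : Fin m × (Fin d ⊕ Unit) → ℝ => splitData (rightMul m T₀ x) :=
    measurable_splitData.comp (measurable_rightMul T₀)
  have hD : Measurable D := by
    have h1 := hf.1.comp hsplit
    have h2 := hcl.1.comp hsplit
    exact ((measurable_pi_apply j).comp h1).sub ((measurable_pi_apply j).comp h2)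
  -- Here unbiasedness at other data enters: replacing `M` by `M T₀⁻¹ T T₀` turns the root `T₀` into
  -- `T T₀`, so every invertible `T` comes from some data pair with full column rank. Both
  -- estimators have the same mean there.
  have hzero : ∀ T : Matrix (Fin d ⊕ Unit) (Fin d ⊕ Unit) ℝ, IsUnit T.det →
      Integrable (fun x => D (rightMul m T x)) (stdNormal (Fin m × (Fin d ⊕ Unit))) ∧
      ∫ x, D (rightMul m T x) ∂stdNormal (Fin m × (Fin d ⊕ Unit)) = 0 := by
    intro T hT
    have hQ : IsUnit (T₀⁻¹ * (T * T₀)).det := by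
      rw [Matrix.det_mul, Matrix.det_mul]
      exact (Matrix.isUnit_nonsing_inv_det _ hT₀).mul (hT.mul hT₀)
    have hM' : Function.Injective (M * (T₀⁻¹ * (T * T₀))).mulVec := by
      have e : (M * (T₀⁻¹ * (T * T₀))).mulVec =
          M.mulVec ∘ (T₀⁻¹ * (T * T₀)).mulVec := by
        funext v; rw [Function.comp_apply, Matrix.mulVec_mulVec]
      rw [e]
      exact hM.comp (Matrix.mulVec_injective_of_isUnit ((Matrix.isUnit_iff_isUnit_det _).2 hQ))
    have hTM : (T * T₀)ᵀ * (T * T₀) =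
        (m : ℝ)⁻¹ • ((M * (T₀⁻¹ * (T * T₀)))ᵀ * (M * (T₀⁻¹ * (T * T₀)))) := by
      have e : (m : ℝ)⁻¹ • ((M * (T₀⁻¹ * (T * T₀)))ᵀ * (M * (T₀⁻¹ * (T * T₀)))) =
          (T₀⁻¹ * (T * T₀))ᵀ * ((m : ℝ)⁻¹ • (Mᵀ * M)) * (T₀⁻¹ * (T * T₀)) := by
        rw [Matrix.transpose_mul M, Matrix.mul_smul, Matrix.smul_mul]
        simp only [Matrix.mul_assoc]
      have e2 : T₀ * (T₀⁻¹ * (T * T₀)) = T * T₀ := by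
        rw [← Matrix.mul_assoc, Matrix.mul_nonsing_inv _ hT₀, Matrix.one_mul]
      rw [e, ← hT₀M, ← Matrix.mul_assoc _ T₀ᵀ, ← Matrix.transpose_mul, e2, Matrix.mul_assoc, e2]
    obtain ⟨h1, h2⟩ := hf.integral_splitData hS hM' hTM
    obtain ⟨h3, h4⟩ := hcl.integral_splitData hS hM' hTM
    simp only [rightMul_mul T T₀] at h1 h2 h3 h4
    refine ⟨(h1.eval j).sub (h3.eval j), ?_⟩
    have h5 := congrFun (h2.trans h4.symm) j
    rw [eval_integral fun k => h1.eval k, eval_integral fun k => h3.eval k] at h5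
    exact (integral_sub (h1.eval j) (h3.eval j)).trans (sub_eq_zero.2 h5)
  simp_rw [hest] at hint ⊢
  have hmS := hS.measurable_toEntries_mul M
  set x₀ := lsSol A y
  have hF : Measurable fun x : Fin m × (Fin d ⊕ Unit) → ℝ =>
      (f (splitData x) j - classicalSketch m d (splitData x) j) *
        (classicalSketch m d (splitData x) l - x₀ l) := by
    have h1 := hf.1.comp (measurable_splitData (m := m) (d := d))
    have h2 := hcl.1.comp (measurable_splitData (m := m) (d := d))
    exact (((measurable_pi_apply j).comp h1).sub ((measurable_pi_apply j).comp h2)).mul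
      (((measurable_pi_apply l).comp h2).sub_const _)
  have hint' := (integrable_map_measure (g := fun x : Fin m × (Fin d ⊕ Unit) → ℝ =>
      (f (splitData x) j - classicalSketch m d (splitData x) j) *
        (classicalSketch m d (splitData x) l - x₀ l)) hF.aestronglyMeasurable
      hmS.aemeasurable).2 hint
  have hval := integral_map (μ := μ) (f := fun x : Fin m × (Fin d ⊕ Unit) → ℝ =>
      (f (splitData x) j - classicalSketch m d (splitData x) j) *
        (classicalSketch m d (splitData x) l - x₀ l)) hmS.aemeasurable hF.aestronglyMeasurable
  rw [hlaw] at hint' hval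
  rw [← hval, integral_map (measurable_rightMul T₀).aemeasurable hF.aestronglyMeasurable]
  have hint'' := (integrable_map_measure hF.aestronglyMeasurable
    (measurable_rightMul T₀).aemeasurable).1 hint'
  have e : ∀ x, (f (splitData (rightMul m T₀ x)) j -
      classicalSketch m d (splitData (rightMul m T₀ x)) j) *
      (classicalSketch m d (splitData (rightMul m T₀ x)) l - x₀ l) =
      D x * (h (gramEntries x) - x₀ l) := fun x => by rw [hols]
  simp_rw [e]
  refine (sameSignedLaw_gramEntries hD hzero).integral_eq_zero hD measurable_gramEntries
    (h := fun w => h w - x₀ l) (hh.sub_const _) (hint''.congr (ae_of_all _ e))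

end Unbiased

end GaussianSketch

/-! ### Assembly of bounds, attainment and infima. -/

theorem theorem1 {Ω : Type*} [MeasurableSpace Ω] (μ : Measure Ω) [IsProbabilityMeasure μ]
    (m n d : ℕ) (hm : d + 1 < m)
    (S : Ω → Matrix (Fin m) (Fin n) ℝ) (hS : GaussianSketch.IsGaussianSketch μ S)
    (A : Matrix (Fin n) (Fin d) ℝ) (hA : A.rank = d) (y : Fin n → ℝ) :
    -- the lower bound for unbiased estimators
    (∀ f : GaussianSketch.Estimator m d, GaussianSketch.IsUnbiased μ S f →
      ENNReal.ofReal (GaussianSketch.errorBound m A y) ≤ GaussianSketch.predError μ S f A y) ∧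
    -- the lower bound for estimators that are unbiased conditionally on `SA`
    (∀ f : GaussianSketch.Estimator m d, GaussianSketch.IsCondUnbiased μ S A y f →
      ENNReal.ofReal (GaussianSketch.errorBound m A y) ≤ GaussianSketch.predError μ S f A y) ∧
    -- the sketched problem almost surely has a unique solution; this estimator is unbiased in
    -- both senses and attains the bound
    (∀ᵐ ω ∂μ, ∃! x, GaussianSketch.IsLeastSquares (S ω * A) (S ω *ᵥ y) x) ∧
    GaussianSketch.IsUnbiased μ S (GaussianSketch.classicalSketch m d) ∧
    GaussianSketch.IsCondUnbiased μ S A y (GaussianSketch.classicalSketch m d) ∧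
    GaussianSketch.predError μ S (GaussianSketch.classicalSketch m d) A y =
      ENNReal.ofReal (GaussianSketch.errorBound m A y) ∧
    -- the bound is tight: it is the infimum of the error over the unbiased estimators
    (⨅ f : {f : GaussianSketch.Estimator m d // GaussianSketch.IsUnbiased μ S f},
        GaussianSketch.predError μ S f.1 A y) =
      ENNReal.ofReal (GaussianSketch.errorBound m A y) ∧
    (⨅ f : {f : GaussianSketch.Estimator m d // GaussianSketch.IsCondUnbiased μ S A y f},
        GaussianSketch.predError μ S f.1 A y) =
      ENNReal.ofReal (GaussianSketch.errorBound m A y) := by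
  have hU := GaussianSketch.isUnbiased_classicalSketch hS hm
  have hC := GaussianSketch.isCondUnbiased_classicalSketch hS hm hA y
  have hE := GaussianSketch.predError_classicalSketch hS hm hA y
  have hLU : ∀ f : GaussianSketch.Estimator m d, GaussianSketch.IsUnbiased μ S f →
      ENNReal.ofReal (GaussianSketch.errorBound m A y) ≤ GaussianSketch.predError μ S f A y :=
    fun f hf => hf.errorBound_le_predError hS hm hA y
  have hLC : ∀ f : GaussianSketch.Estimator m d, GaussianSketch.IsCondUnbiased μ S A y f →
      ENNReal.ofReal (GaussianSketch.errorBound m A y) ≤ GaussianSketch.predError μ S f A y :=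
    fun f hf => hf.errorBound_le_predError hS hm hA
  refine ⟨hLU, hLC, GaussianSketch.ae_existsUnique_isLeastSquares hS hm hA y, hU, hC, hE,
    le_antisymm ?_ (le_iInf fun f => hLU f.1 f.2), le_antisymm ?_ (le_iInf fun f => hLC f.1 f.2)⟩
  · exact iInf_le_of_le ⟨GaussianSketch.classicalSketch m d, hU⟩ hE.le
  · exact iInf_le_of_le ⟨GaussianSketch.classicalSketch m d, hC⟩ hE.le
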